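/- Let $q \ge 2$ be an integer and let $\chi$ be a primitive Dirichlet character modulo $q$. Let $\mathcal{S}$ be any finite (possibly empty) subset of the non-trivial zeros of $L(s,\chi)$, that is, of its zeros in the strip $0 < \Re(s) < 1$, where zeros are counted with multiplicity (so $\mathcal{S}$ is a finite multiset of non-trivial zeros in which each zero occurs at most as often as its multiplicity, and $|\mathcal{S}|$ and the sum below count with multiplicity). Then \[ \sum_{\varrho\in\mathcal{S}} \Re\Big(\frac{1}{1-\varrho}\Big) < \Big(1-\frac{1}{\sqrt5}\Big)\frac12\log q + \Re\Big(\frac{L'}{L}(1,\chi)\Big) + \Big(1+\frac{1}{\sqrt5}\Big)\frac{2|\mathcal{S}|+3}{2} - 1. \] -/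

import Mathlib

namespace DirichletCharacter

/-- `ρ` is a non-trivial zero of `L(s, χ)`: a zero in the open critical strip `0 < Re s < 1`. -/
def IsNontrivialZero {q : ℕ} [NeZero q] (χ : DirichletCharacter ℂ q) (ρ : ℂ) : Prop :=
  0 < ρ.re ∧ ρ.re < 1 ∧ χ.LFunction ρ = 0

/-- `S` is a finite sub-multiset of the multiset of non-trivial zeros of `L(s, χ)`, in which each
zero occurs as often as its order of vanishing. -/
def IsFiniteFamilyOfNontrivialZeros {q : ℕ} [NeZero q] (χ : DirichletCharacter ℂ q)
    (S : Multiset ℂ) : Prop :=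
  ∀ ρ ∈ S, χ.IsNontrivialZero ρ ∧ (S.count ρ : ℕ∞) ≤ analyticOrderAt χ.LFunction ρ

end DirichletCharacter

open Complex Metric Filter Topology Set
open scoped ComplexConjugate

/-! Let ξ(s) = q^(s/2) Λ(s, χ). This function is entire, is bounded by exp(C(1+|s|)^(3/2)), has all
its zeros in the open critical strip, and satisfies ξ(1 - s̄) = W · conj ξ(s). So Re ξ'/ξ(s) is the
sum of Re 1/(s - ρ) over the zeros, which come in pairs ρ, 1 - ρ̄.

Let κ = 1/√5 and let φ be the golden ratio. By `stechkin_inequality` every pair contributes a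
nonnegative amount to Re ξ'/ξ(1) - κ Re ξ'/ξ(φ). Hence all zeros may be dropped except the symmetric
closure T of S. On T the κ-weighted part at φ is at most 1 per pair, a total cost of at most |T|/2 ≤
|S|. This is `sum_re_one_div_one_sub_le`.

The partial fractions are only needed up to ε. Divide out the zeros in a disc of radius R around a
point w of the critical line; by Borel–Carathéodory the logarithmic derivative of the cofactor
changes by O(R^(-1/2)) between w and a fixed point, and at w all real parts vanish by symmetry.

Expanding ξ'/ξ, the power of q gives (1-κ)/2 · log q, the gamma factors give at most -(1-κ)/2 · log
π (`re_logDeriv_gammaFactor_sub_le`), and |L'/L(φ)| ≤ 63/20 (`norm_logDeriv_LFunction_le`). -/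

/-! ### Splitting finitely many zeros off an entire function -/

theorem Differentiable.exists_eq_sub_pow_mul {f : ℂ → ℂ} (hf : Differentiable ℂ f) {ρ : ℂ}
    (hρ : analyticOrderAt f ρ ≠ ⊤) :
    ∃ (n : ℕ) (g : ℂ → ℂ), Differentiable ℂ g ∧ g ρ ≠ 0 ∧ ∀ s, f s = (s - ρ) ^ n * g s := by
  obtain ⟨n, hn⟩ := ENat.ne_top_iff_exists.mp hρ
  obtain ⟨g, hg, hg0, hfg⟩ := (hf.analyticAt ρ).analyticOrderAt_eq_natCast.mp hn.symm
  have key : ∀ s, f s = (s - ρ) ^ n * Function.update (fun s => f s / (s - ρ) ^ n) ρ (g ρ) s := by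
    intro s
    rcases eq_or_ne s ρ with rfl | hs
    · simpa using hfg.self_of_nhds
    · rw [Function.update_of_ne hs, mul_div_cancel₀ _ (pow_ne_zero _ (sub_ne_zero.mpr hs))]
  refine ⟨n, _, fun s => ?_, by simpa using hg0, key⟩
  rcases eq_or_ne s ρ with rfl | hs
  · refine hg.differentiableAt.congr_of_eventuallyEq ?_
    filter_upwards [hfg] with z hz
    rcases eq_or_ne z s with rfl | hzs
    · simp
    · rw [Function.update_of_ne hzs, hz, smul_eq_mul,
        mul_div_cancel_left₀ _ (pow_ne_zero _ (sub_ne_zero.mpr hzs))]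
  · have h1 : DifferentiableAt ℂ (fun s => f s / (s - ρ) ^ n) s :=
      (hf s).div (by fun_prop) (pow_ne_zero _ (sub_ne_zero.mpr hs))
    refine h1.congr_of_eventuallyEq ?_
    filter_upwards [isOpen_ne.mem_nhds hs] with z hz
    rw [Function.update_of_ne hz]

theorem Differentiable.analyticOrderAt_ne_top {f : ℂ → ℂ} (hf : Differentiable ℂ f) {w : ℂ}
    (hw : f w ≠ 0) (s : ℂ) : analyticOrderAt f s ≠ ⊤ := by
  intro h
  rw [analyticOrderAt_eq_top] at h
  have := AnalyticOnNhd.eqOn_zero_of_preconnected_of_eventuallyEq_zero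
    (f := f) (U := univ) (fun z _ => hf.analyticAt z) isPreconnected_univ (mem_univ s) h
  exact hw (this (mem_univ w))

/-- Dividing an entire function by a finite number of its zeros. -/
theorem Differentiable.exists_eq_multiset_prod_mul_of_finset {f : ℂ → ℂ} (hf : Differentiable ℂ f)
    {w : ℂ} (hw : f w ≠ 0) (F : Finset ℂ) :
    ∃ (Z : Multiset ℂ) (g : ℂ → ℂ), Differentiable ℂ g ∧ (∀ ρ ∈ Z, ρ ∈ F) ∧
      (∀ s ∈ F, g s ≠ 0) ∧ ∀ s, f s = (Z.map (s - ·)).prod * g s := by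
  classical
  induction F using Finset.induction_on with
  | empty => exact ⟨0, f, hf, by simp, by simp, by simp⟩
  | insert ρ F hρ ih =>
    obtain ⟨Z, g, hg, hZ, hgF, hfg⟩ := ih
    have hgw : g w ≠ 0 := fun h => hw (by rw [hfg, h, mul_zero])
    obtain ⟨n, h, hh, hh0, hgh⟩ := hg.exists_eq_sub_pow_mul (hg.analyticOrderAt_ne_top hgw ρ)
    refine ⟨Z + Multiset.replicate n ρ, h, hh, fun σ hσ => ?_, fun s hs => ?_, fun s => ?_⟩
    · rcases Multiset.mem_add.mp hσ with h1 | h1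
      · exact Finset.mem_insert_of_mem (hZ σ h1)
      · rw [Multiset.eq_of_mem_replicate h1]; exact Finset.mem_insert_self _ _
    · rcases Finset.mem_insert.mp hs with rfl | hs
      · exact hh0
      · exact fun h0 => hgF s hs (by rw [hgh, h0, mul_zero])
    · rw [hfg, hgh]; simp [mul_assoc]

theorem Differentiable.finite_zeros_inter {f : ℂ → ℂ} (hf : Differentiable ℂ f)
    {w : ℂ} (hw : f w ≠ 0) {K : Set ℂ} (hK : IsCompact K) : {s ∈ K | f s = 0}.Finite := by
  by_contra hinf
  obtain ⟨x, hxK, hx⟩ := Set.Infinite.exists_accPt_of_subset_isCompact hinf hK (fun s hs => hs.1)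
  have hfr : ∃ᶠ z in 𝓝[≠] x, f z = 0 := by
    rw [accPt_iff_frequently_nhdsNE] at hx
    exact hx.mono fun z hz => hz.2
  have := AnalyticOnNhd.eqOn_zero_of_preconnected_of_frequently_eq_zero
    (f := f) (U := univ) (fun z _ => hf.analyticAt z) isPreconnected_univ (mem_univ x) hfr
  exact hw (this (mem_univ w))

/-- An entire function is the product of a polynomial having all its zeros in a given compact set
and an entire function without zeros in this set. -/
theorem Differentiable.exists_eq_multiset_prod_mul {f : ℂ → ℂ} (hf : Differentiable ℂ f)
    {w : ℂ} (hw : f w ≠ 0) {K : Set ℂ} (hK : IsCompact K) :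
    ∃ (Z : Multiset ℂ) (g : ℂ → ℂ), Differentiable ℂ g ∧ (∀ ρ ∈ Z, ρ ∈ K ∧ f ρ = 0) ∧
      (∀ s ∈ K, g s ≠ 0) ∧ ∀ s, f s = (Z.map (s - ·)).prod * g s := by
  have hfin := hf.finite_zeros_inter hw hK
  obtain ⟨Z, g, hg, hZ, hgF, hfg⟩ := hf.exists_eq_multiset_prod_mul_of_finset hw hfin.toFinset
  refine ⟨Z, g, hg, fun ρ hρ => by simpa using hZ ρ hρ, fun s hs h0 => ?_, hfg⟩
  exact hgF s (by simpa [hs] using by rw [hfg, h0, mul_zero]) h0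

theorem differentiable_multiset_prod_sub (Z : Multiset ℂ) :
    Differentiable ℂ fun s : ℂ => (Z.map (s - ·)).prod := by
  induction Z using Multiset.induction_on with
  | empty => simp
  | cons a Z ih => simp only [Multiset.map_cons, Multiset.prod_cons]; fun_prop

theorem analyticOrderAt_multiset_prod_sub (Z : Multiset ℂ) (ρ : ℂ) :
    analyticOrderAt (fun s : ℂ => (Z.map (s - ·)).prod) ρ = Z.count ρ := by
  induction Z using Multiset.induction_on with
  | empty => simp [analyticOrderAt_eq_zero]
  | cons a Z ih =>
    have h1 : AnalyticAt ℂ (fun s : ℂ => s - a) ρ := by fun_prop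
    have h2 := (differentiable_multiset_prod_sub Z).analyticAt ρ
    have : (fun s : ℂ => ((a ::ₘ Z).map (s - ·)).prod) =
        (fun s => s - a) * fun s => (Z.map (s - ·)).prod := by ext s; simp
    rw [this, analyticOrderAt_mul h1 h2, ih, Multiset.count_cons]
    rcases eq_or_ne ρ a with rfl | h
    · have : analyticOrderAt (fun s : ℂ => s - ρ) ρ = (1 : ℕ) := by
        rw [h1.analyticOrderAt_eq_natCast]
        exact ⟨fun _ => 1, analyticAt_const, one_ne_zero, by simp⟩
      rw [this]; simp [add_comm]
    · have : analyticOrderAt (fun s : ℂ => s - a) ρ = 0 :=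
        analyticOrderAt_eq_zero.mpr (Or.inr (sub_ne_zero.mpr h))
      rw [this]; simp [h]

/-- Where the cofactor does not vanish, the polynomial part carries the whole order of `f`. This
turns comparisons of multisets of zeros into comparisons of orders of vanishing. -/
theorem count_eq_analyticOrderAt {f g : ℂ → ℂ} {Z : Multiset ℂ} (hg : Differentiable ℂ g)
    (hfg : ∀ s, f s = (Z.map (s - ·)).prod * g s) {ρ : ℂ} (hρ : g ρ ≠ 0) :
    (Z.count ρ : ℕ∞) = analyticOrderAt f ρ := by
  have : f = (fun s : ℂ => (Z.map (s - ·)).prod) * g := funext hfg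
  rw [this, analyticOrderAt_mul ((differentiable_multiset_prod_sub Z).analyticAt ρ)
    (hg.analyticAt ρ), analyticOrderAt_multiset_prod_sub,
    analyticOrderAt_eq_zero.mpr (Or.inr hρ), add_zero]

theorem logDeriv_multiset_prod_sub (Z : Multiset ℂ) {s : ℂ} (hs : s ∉ Z) :
    logDeriv (fun s : ℂ => (Z.map (s - ·)).prod) s = (Z.map fun ρ => 1 / (s - ρ)).sum := by
  induction Z using Multiset.induction_on with
  | empty => simp
  | cons a Z ih =>
    rw [Multiset.mem_cons, not_or] at hs
    simp only [Multiset.map_cons, Multiset.prod_cons, Multiset.sum_cons]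
    rw [logDeriv_mul (f := fun s => s - a) s (sub_ne_zero.mpr hs.1) _ (by fun_prop)
      (differentiable_multiset_prod_sub Z s), ih hs.2, logDeriv_apply]
    · simp
    · rw [ne_eq, Multiset.prod_eq_zero_iff, Multiset.mem_map]
      rintro ⟨b, hb, h0⟩
      exact hs.2 (sub_eq_zero.mp h0 ▸ hb)

theorem logDeriv_eq_sum_add_logDeriv {f g : ℂ → ℂ} {Z : Multiset ℂ} (hg : Differentiable ℂ g)
    (hfg : ∀ s, f s = (Z.map (s - ·)).prod * g s) {s : ℂ} (hs : f s ≠ 0) :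
    logDeriv f s = (Z.map fun ρ => 1 / (s - ρ)).sum + logDeriv g s := by
  have h := hs
  rw [hfg, mul_ne_zero_iff] at h
  have hsZ : s ∉ Z := fun hm => h.1 (Multiset.prod_eq_zero_iff.mpr
    (Multiset.mem_map.mpr ⟨s, hm, sub_self s⟩))
  rw [funext hfg, logDeriv_mul s h.1 h.2 (differentiable_multiset_prod_sub Z s) (hg s),
    logDeriv_multiset_prod_sub Z hsZ]

/-! ### Partial fractions up to a small error -/

/-- A branch of log(g/g(w)): a disc provides a primitive `h` of g'/g, and g·exp(-h) has derivative
zero. -/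
theorem exists_primitive_logDeriv {g : ℂ → ℂ} (hg : Differentiable ℂ g) {w : ℂ} {R : ℝ}
    (h0 : ∀ s ∈ ball w R, g s ≠ 0) (hR : 0 < R) :
    ∃ h : ℂ → ℂ, h w = 0 ∧ (∀ s ∈ ball w R, HasDerivAt h (logDeriv g s) s) ∧
      ∀ s ∈ ball w R, g s = g w * exp (h s) := by
  have hd : DifferentiableOn ℂ (logDeriv g) (ball w R) := fun s hs =>
    ((hg.analyticAt s).deriv.differentiableAt.div (hg s) (h0 s hs)).differentiableWithinAt
  obtain ⟨h, hw, hh⟩ := hd.isExactOn_ball.with_val_at w 0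
  refine ⟨h, hw, hh, fun s hs => ?_⟩
  have hder : ∀ z ∈ ball w R, HasDerivAt (fun z => g z * exp (-h z)) 0 z := fun z hz => by
    have := (hg z).hasDerivAt.mul (hh z hz).fun_neg.cexp
    refine this.congr_deriv ?_
    rw [logDeriv_apply]
    field_simp [h0 z hz]
    ring
  have hconst := (convex_ball w R).is_const_of_fderivWithin_eq_zero (𝕜 := ℂ)
    (f := fun z => g z * exp (-h z))
    (fun z hz => (hder z hz).differentiableAt.differentiableWithinAt) (fun z hz => by
      rw [fderivWithin_of_isOpen isOpen_ball hz, (hder z hz).hasFDerivAt.fderiv]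
      ext; simp) (mem_ball_self hR) hs
  simp only [hw, neg_zero, exp_zero, mul_one] at hconst
  rw [hconst, mul_assoc, ← exp_add]
  simp

/-- The logarithmic derivative of a zero-free function varies slowly, if the function does not
grow too fast. -/
theorem norm_logDeriv_sub_le {g : ℂ → ℂ} (hg : Differentiable ℂ g) {w : ℂ} {R M : ℝ}
    (h0 : ∀ s ∈ ball w R, g s ≠ 0) (hR : 0 < R) (hM : 0 < M)
    (hgM : ∀ s ∈ ball w R, ‖g s‖ ≤ Real.exp M * ‖g w‖) {z : ℂ} (hz : z ∈ ball w (R / 4)) :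
    ‖logDeriv g z - logDeriv g w‖ ≤ 64 * M * ‖z - w‖ / R ^ 2 := by
  obtain ⟨h, hw, hh, hexp⟩ := exists_primitive_logDeriv hg h0 hR
  have hgw : 0 < ‖g w‖ := norm_pos_iff.mpr (h0 w (mem_ball_self hR))
  have hre : ∀ s ∈ ball w R, (h s).re ≤ M := fun s hs => by
    have := hgM s hs
    rw [hexp s hs, norm_mul, norm_exp, mul_comm] at this
    exact Real.exp_le_exp.mp (le_of_mul_le_mul_right this hgw)
  have hdiff : DifferentiableOn ℂ h (ball w R) := fun s hs =>
    (hh s hs).differentiableAt.differentiableWithinAt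
  -- Borel–Carathéodory at half the radius: 2M·r/(R - r) ≤ 2M for r ≤ R/2.
  have hbound : ∀ s ∈ closedBall w (R / 2), ‖h s‖ ≤ 2 * M := fun s hs => by
    rw [mem_closedBall, dist_eq_norm] at hs
    have hmap : MapsTo (fun z => w + z) (ball 0 R) (ball w R) := fun z hz => by
      simpa [dist_eq_norm] using hz
    have := borelCaratheodory_zero (f := fun z => h (w + z)) (R := R) (z := s - w) hM
      (hdiff.comp (by fun_prop) hmap) (fun z hz => hre _ (hmap hz)) hR
      (by rw [mem_ball_zero_iff]; linarith) (by simpa using hw)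
    simp only [add_sub_cancel] at this
    refine this.trans ?_
    rw [div_le_iff₀ (by linarith)]
    nlinarith
  -- Cauchy's estimate on circles of radius R/4: 2M/(R/4) = 8M/R.
  have hu : ∀ s ∈ ball w (R / 4), ‖logDeriv g s‖ ≤ 8 * M / R := fun s hs => by
    rw [mem_ball] at hs
    have hsub : closedBall s (R / 4) ⊆ closedBall w (R / 2) :=
      closedBall_subset_closedBall' (by linarith)
    have hsub' : closedBall s (R / 4) ⊆ ball w R :=
      hsub.trans (closedBall_subset_ball (by linarith))
    have hd : DiffContOnCl ℂ h (ball s (R / 4)) :=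
      (hdiff.mono hsub').diffContOnCl_ball (subset_refl _)
    have := norm_deriv_le_of_forall_mem_sphere_norm_le (by positivity) hd
      (fun z hz => hbound z (hsub (sphere_subset_closedBall hz)))
    rw [(hh s (hsub' (mem_closedBall_self (by positivity)))).deriv] at this
    exact this.trans_eq (by field_simp; norm_num)
  have hd : DifferentiableOn ℂ (logDeriv g) (ball w (R / 4)) := fun s hs =>
    ((hg.analyticAt s).deriv.differentiableAt.div (hg s)
      (h0 s (ball_subset_ball (by linarith) hs))).differentiableWithinAt
  -- Schwarz's lemma on the disc of radius R/4, where the values stay within 16M/R of the value at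
  -- the centre.
  have := dist_le_div_mul_dist_of_mapsTo_ball (R₂ := 16 * M / R) hd (fun s hs => by
    rw [mem_closedBall, dist_eq_norm]
    refine (norm_sub_le _ _).trans ?_
    have h1 := hu s hs
    have h2 := hu w (mem_ball_self (by positivity))
    calc _ ≤ 8 * M / R + 8 * M / R := add_le_add h1 h2
      _ = _ := by ring) hz
  rw [dist_eq_norm, dist_eq_norm] at this
  refine this.trans_eq ?_
  field_simp
  ring

/-- Dividing out the zeros in a disc does not enlarge the relative growth in this disc. -/
theorem norm_le_of_eq_multiset_prod_mul {f g : ℂ → ℂ} {Z : Multiset ℂ} (hg : Differentiable ℂ g)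
    (hfg : ∀ s, f s = (Z.map (s - ·)).prod * g s) {w : ℂ} {R B : ℝ} (hR : 0 < R)
    (hZ : ∀ ρ ∈ Z, ρ ∈ closedBall w R) (hw : f w ≠ 0)
    (hB : ∀ s ∈ sphere w (2 * R), ‖f s‖ ≤ B * ‖f w‖) :
    ∀ s ∈ ball w R, ‖g s‖ ≤ B * ‖g w‖ := by
  have hw' := hw
  rw [hfg, mul_ne_zero_iff] at hw'
  have hsph : ∀ s ∈ sphere w (2 * R), ‖g s‖ ≤ B * ‖g w‖ := fun s hs => by
    -- At distance 2R from w, each factor satisfies |s - ρ| ≥ R ≥ |w - ρ|. The maximum principle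
    -- then carries the bound inwards.
    have hprod : ‖(Z.map (w - ·)).prod‖ ≤ ‖(Z.map (s - ·)).prod‖ := by
      clear hw' hfg hw
      induction Z using Multiset.induction_on with
      | empty => simp
      | cons a Z ih =>
        simp only [Multiset.map_cons, Multiset.prod_cons, norm_mul]
        have ha := hZ a (Multiset.mem_cons_self a Z)
        have hs' : ‖s - w‖ = 2 * R := by simpa [dist_eq_norm] using hs
        have ha' : ‖w - a‖ ≤ R := by simpa [dist_eq_norm, norm_sub_rev] using ha
        refine mul_le_mul ?_ (ih fun ρ hρ => hZ ρ (Multiset.mem_cons_of_mem hρ))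
          (norm_nonneg _) (norm_nonneg _)
        have := norm_sub_le (s - a) (w - a)
        rw [sub_sub_sub_cancel_right] at this
        linarith
    have h1 := hB s hs
    rw [hfg s, hfg w, norm_mul, norm_mul] at h1
    have hpos : 0 < ‖(Z.map (w - ·)).prod‖ := norm_pos_iff.mpr hw'.1
    refine le_of_mul_le_mul_left ?_ hpos
    calc _ ≤ ‖(Z.map (s - ·)).prod‖ * ‖g s‖ := by gcongr
      _ ≤ _ := h1
      _ = _ := by ring
  intro s hs
  refine norm_le_of_forall_mem_frontier_norm_le (isBounded_ball (x := w) (r := 2 * R))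
    hg.diffContOnCl (fun z hz => hsph z ?_)
    (subset_closure (ball_subset_ball (by linarith) hs))
  rwa [frontier_ball w (by positivity)] at hz

/-- The partial fraction decomposition of the logarithmic derivative of an entire function of
order less than two, up to an arbitrarily small error. -/
theorem eventually_norm_logDeriv_sub_le {f : ℂ → ℂ} {C : ℝ}
    (hC : ∀ s, ‖f s‖ ≤ Real.exp (C * (1 + ‖s‖) ^ (3 / 2 : ℝ))) {w : ℂ} (hw : f w ≠ 0) (z : ℂ)
    {ε : ℝ} (hε : 0 < ε) :
    ∀ᶠ R : ℝ in atTop, ∀ (Z : Multiset ℂ) (g : ℂ → ℂ), Differentiable ℂ g →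
      (∀ s, f s = (Z.map (s - ·)).prod * g s) → (∀ ρ ∈ Z, ρ ∈ closedBall w R) →
      (∀ s ∈ closedBall w R, g s ≠ 0) → ‖logDeriv g z - logDeriv g w‖ ≤ ε := by
  set D : ℝ := |C| + 1 + |Real.log ‖f w‖|
  have hlim : Tendsto (fun R : ℝ => 64 * (D * (1 + ‖w‖ + 2 * R) ^ (3 / 2 : ℝ)) * ‖z - w‖ / R ^ 2)
      atTop (𝓝 0) := by
    have h1 : Tendsto (fun R : ℝ => (1 + ‖w‖) * R⁻¹ + 2) atTop (𝓝 ((1 + ‖w‖) * 0 + 2)) :=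
      (tendsto_inv_atTop_zero.const_mul _).add_const _
    have h2 := (h1.rpow_const (p := 3 / 2) (Or.inr (by norm_num))).mul
      (tendsto_rpow_neg_atTop (y := 1 / 2) (by norm_num))
    have h3 := h2.const_mul (64 * D * ‖z - w‖)
    rw [mul_zero, mul_zero] at h3
    refine h3.congr' ?_
    filter_upwards [eventually_gt_atTop 0] with R hR
    have e1 : 1 + ‖w‖ + 2 * R = ((1 + ‖w‖) * R⁻¹ + 2) * R := by field_simp
    have e2 : R ^ (-(1 / 2) : ℝ) = R ^ (3 / 2 : ℝ) / R ^ 2 := by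
      rw [← Real.rpow_natCast R 2, ← Real.rpow_sub hR]; norm_num
    rw [e1, Real.mul_rpow (by positivity) hR.le, e2]
    ring
  filter_upwards [hlim.eventually_le_const hε, eventually_gt_atTop 0,
    eventually_gt_atTop (4 * ‖z - w‖)] with R hRε hR hRz Z g hg hfg hZ hg0
  have hfw : 0 < ‖f w‖ := norm_pos_iff.mpr hw
  have hone : 1 ≤ (1 + ‖w‖ + 2 * R) ^ (3 / 2 : ℝ) :=
    Real.one_le_rpow (by linarith [norm_nonneg w]) (by norm_num)
  have hD : 0 < D := by positivity
  refine (norm_logDeriv_sub_le hg (fun s hs => hg0 s (ball_subset_closedBall hs)) hR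
    (M := D * (1 + ‖w‖ + 2 * R) ^ (3 / 2 : ℝ)) (by positivity) ?_
    (by rw [mem_ball, dist_eq_norm]; linarith)).trans hRε
  refine norm_le_of_eq_multiset_prod_mul hg hfg hR hZ hw fun s hs => ?_
  have hs' : ‖s‖ ≤ ‖w‖ + 2 * R := by
    have h1 : ‖s - w‖ = 2 * R := by simpa [dist_eq_norm] using hs
    have := norm_add_le (s - w) w
    rw [sub_add_cancel] at this
    linarith
  have hX : (1 + ‖s‖) ^ (3 / 2 : ℝ) ≤ (1 + ‖w‖ + 2 * R) ^ (3 / 2 : ℝ) :=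
    Real.rpow_le_rpow (by positivity) (by linarith) (by norm_num)
  set X := (1 + ‖w‖ + 2 * R) ^ (3 / 2 : ℝ)
  conv_rhs => rw [← Real.exp_log hfw, ← Real.exp_add]
  refine (hC s).trans (Real.exp_le_exp.mpr ?_)
  have h1 : C * (1 + ‖s‖) ^ (3 / 2 : ℝ) ≤ |C| * X :=
    mul_le_mul (le_abs_self C) hX (by positivity) (abs_nonneg C)
  have h2 : -Real.log ‖f w‖ ≤ |Real.log ‖f w‖| * X :=
    (neg_le_abs _).trans (le_mul_of_one_le_right (abs_nonneg _) hone)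
  have h3 : D * X = |C| * X + X + |Real.log ‖f w‖| * X := by ring
  linarith

/-! ### Reflection in the critical line and Stechkin's inequality for a pair of zeros -/

/-- The reflection in the critical line. -/
def criticalReflection (s : ℂ) : ℂ := 1 - conj s

theorem criticalReflection_involutive : Function.Involutive criticalReflection := fun s => by
  simp [criticalReflection]

theorem sub_criticalReflection (s ρ : ℂ) :
    s - criticalReflection ρ = -conj (criticalReflection s - ρ) := by
  simp only [criticalReflection, map_sub, map_one, conj_conj]; ring

theorem criticalReflection_eq_self {w : ℂ} (hw : w.re = 1 / 2) : criticalReflection w = w := by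
  apply Complex.ext <;> simp [criticalReflection, hw]; norm_num

theorem multiset_prod_sub_criticalReflection (Z : Multiset ℂ) (s : ℂ) :
    ((Z.map criticalReflection).map (s - ·)).prod =
      (-1) ^ Z.card * conj ((Z.map (criticalReflection s - ·)).prod) := by
  induction Z using Multiset.induction_on with
  | empty => simp
  | cons a Z ih =>
    simp only [Multiset.map_cons, Multiset.prod_cons, Multiset.card_cons, map_mul, pow_succ,
      sub_criticalReflection s a, ih]
    ring

theorem re_one_div_ofReal_sub (a : ℝ) (ρ : ℂ) :
    (1 / ((a : ℂ) - ρ)).re = (a - ρ.re) / ((a - ρ.re) ^ 2 + ρ.im ^ 2) := by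
  rw [one_div, inv_re, normSq_apply]
  simp [sq]

/-- The right side depends on A and B only through A + B and AB, which makes the pairs at 1 and at φ
comparable. -/
theorem div_sq_add_add_div_sq_add {A B y : ℝ} (hA : 0 < A) (hB : 0 < B) (hy : 0 ≤ y) :
    A / (A ^ 2 + y) + B / (B ^ 2 + y) =
      (A + B) * (A * B + y) / ((A * B + y) ^ 2 + y * ((A + B) ^ 2 - 4 * (A * B))) := by
  have h1 : A ^ 2 + y ≠ 0 := by positivity
  have h2 : B ^ 2 + y ≠ 0 := by positivity
  have h3 : (A * B + y) ^ 2 + y * ((A + B) ^ 2 - 4 * (A * B)) ≠ 0 := by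
    have : (A * B + y) ^ 2 + y * ((A + B) ^ 2 - 4 * (A * B)) =
      (A * B + y) ^ 2 + y * (A - B) ^ 2 := by ring
    rw [this]; positivity
  rw [div_add_div _ _ h1 h2, div_eq_div_iff (mul_ne_zero h1 h2) h3]
  ring

theorem re_one_div_one_sub_pair {ρ : ℂ} (h0 : 0 < ρ.re) (h1 : ρ.re < 1) :
    (1 / (1 - ρ)).re + (1 / (1 - criticalReflection ρ)).re =
      (ρ.re * (1 - ρ.re) + ρ.im ^ 2) / ((ρ.re * (1 - ρ.re) + ρ.im ^ 2) ^ 2 +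
        ρ.im ^ 2 * (1 - 4 * (ρ.re * (1 - ρ.re)))) := by
  have e1 := re_one_div_ofReal_sub 1 ρ
  have e2 := re_one_div_ofReal_sub 1 (criticalReflection ρ)
  rw [ofReal_one] at e1 e2
  rw [e1, e2]
  have := div_sq_add_add_div_sq_add (A := 1 - ρ.re) (B := ρ.re) (y := ρ.im ^ 2) (by linarith) h0
    (sq_nonneg _)
  simp only [criticalReflection, sub_re, sub_im, conj_re, conj_im, one_re, one_im]
  rw [show (1 : ℝ) - (1 - ρ.re) = ρ.re by ring, show (0 : ℝ) - -ρ.im = ρ.im by ring, this]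
  ring_nf

/-- The reason for φ and 1/√5: since 2φ - 1 = √5 and φ² - φ = 1, the sum is √5 and the product is 1
+ x, with x = β(1-β). So (A+B)² - 4AB equals 1 - 4x, as it does at the point 1. Both pairs are then
values of t/(t² + c) with the same c, at t = x + γ² and at t + 1. -/
theorem re_one_div_goldenRatio_sub_pair {ρ : ℂ} (h0 : 0 < ρ.re) (h1 : ρ.re < 1) :
    1 / √5 * ((1 / ((Real.goldenRatio : ℂ) - ρ)).re +
      (1 / ((Real.goldenRatio : ℂ) - criticalReflection ρ)).re) =
      (1 + (ρ.re * (1 - ρ.re) + ρ.im ^ 2)) / ((1 + (ρ.re * (1 - ρ.re) + ρ.im ^ 2)) ^ 2 +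
        ρ.im ^ 2 * (1 - 4 * (ρ.re * (1 - ρ.re)))) := by
  have hφ := Real.one_lt_goldenRatio
  have h5 : 0 < √5 := by positivity
  have hφ5 : 2 * Real.goldenRatio - 1 = √5 := by rw [Real.goldenRatio]; ring
  have hsq := Real.goldenRatio_sq
  rw [re_one_div_ofReal_sub, re_one_div_ofReal_sub]
  have := div_sq_add_add_div_sq_add (A := Real.goldenRatio - ρ.re)
    (B := Real.goldenRatio - 1 + ρ.re) (y := ρ.im ^ 2) (by linarith) (by linarith) (sq_nonneg _)
  simp only [criticalReflection, sub_re, sub_im, conj_re, conj_im, one_re, one_im]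
  rw [show Real.goldenRatio - (1 - ρ.re) = Real.goldenRatio - 1 + ρ.re by ring,
    show (0 : ℝ) - -ρ.im = ρ.im by ring, this]
  have hsum : Real.goldenRatio - ρ.re + (Real.goldenRatio - 1 + ρ.re) = √5 := by
    rw [← hφ5]; ring
  have hprod : (Real.goldenRatio - ρ.re) * (Real.goldenRatio - 1 + ρ.re) =
      1 + ρ.re * (1 - ρ.re) := by linear_combination hsq
  rw [hsum, hprod, Real.sq_sqrt (by norm_num)]
  field_simp
  congr 1 <;> ring

/-- **Stechkin's inequality**. -/
theorem stechkin_inequality {ρ : ℂ} (h0 : 0 < ρ.re) (h1 : ρ.re < 1) :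
    1 / √5 * ((1 / ((Real.goldenRatio : ℂ) - ρ)).re +
      (1 / ((Real.goldenRatio : ℂ) - criticalReflection ρ)).re) ≤
    (1 / (1 - ρ)).re + (1 / (1 - criticalReflection ρ)).re := by
  rw [re_one_div_goldenRatio_sub_pair h0 h1, re_one_div_one_sub_pair h0 h1]
  have hx : 0 < ρ.re * (1 - ρ.re) := mul_pos h0 (by linarith)
  have hx4 : 0 ≤ 1 - 4 * (ρ.re * (1 - ρ.re)) := by nlinarith [sq_nonneg (2 * ρ.re - 1)]
  set x := ρ.re * (1 - ρ.re)
  have hy : 0 ≤ ρ.im ^ 2 := sq_nonneg _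
  set y := ρ.im ^ 2
  have hc : 0 ≤ y * (1 - 4 * x) := mul_nonneg hy hx4
  rw [div_le_div_iff₀ (by positivity) (by positivity)]
  nlinarith [mul_nonneg hx.le hy]

theorem re_one_div_goldenRatio_sub_pair_le {ρ : ℂ} (h0 : 0 < ρ.re) (h1 : ρ.re < 1) :
    1 / √5 * ((1 / ((Real.goldenRatio : ℂ) - ρ)).re +
      (1 / ((Real.goldenRatio : ℂ) - criticalReflection ρ)).re) ≤ 1 := by
  rw [re_one_div_goldenRatio_sub_pair h0 h1]
  have hx : 0 < ρ.re * (1 - ρ.re) := mul_pos h0 (by linarith)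
  have hx4 : 0 ≤ 1 - 4 * (ρ.re * (1 - ρ.re)) := by nlinarith [sq_nonneg (2 * ρ.re - 1)]
  set x := ρ.re * (1 - ρ.re)
  have hy : 0 ≤ ρ.im ^ 2 := sq_nonneg _
  set y := ρ.im ^ 2
  have hc : 0 ≤ y * (1 - 4 * x) := mul_nonneg hy hx4
  rw [div_le_one (by positivity)]
  nlinarith

theorem re_one_div_one_sub_pos {ρ : ℂ} (h1 : ρ.re < 1) : 0 < (1 / (1 - ρ)).re := by
  have := re_one_div_ofReal_sub 1 ρ
  rw [ofReal_one] at this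
  rw [this]
  have : 0 < 1 - ρ.re := by linarith
  positivity

theorem Multiset.re_sum_map (Z : Multiset ℂ) (h : ℂ → ℂ) :
    (Z.map h).sum.re = (Z.map fun ρ => (h ρ).re).sum := by
  induction Z using Multiset.induction_on with
  | empty => simp
  | cons a Z ih => simp [ih]

theorem Multiset.sum_map_le_sum_map_of_le {Y Z : Multiset ℂ} (hYZ : Y ≤ Z) {h : ℂ → ℝ}
    (h0 : ∀ ρ ∈ Z, 0 ≤ h ρ) : (Y.map h).sum ≤ (Z.map h).sum := by
  obtain ⟨U, rfl⟩ := Multiset.le_iff_exists_add.mp hYZ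
  rw [Multiset.map_add, Multiset.sum_add]
  refine le_add_of_nonneg_right (Multiset.sum_nonneg fun x hx => ?_)
  obtain ⟨ρ, hρ, rfl⟩ := Multiset.mem_map.mp hx
  exact h0 ρ (Multiset.mem_add.mpr (Or.inr hρ))

theorem Multiset.two_mul_sum_map_of_map_eq {Z : Multiset ℂ} {r : ℂ → ℂ} (hZ : Z.map r = Z)
    (h : ℂ → ℝ) : 2 * (Z.map h).sum = (Z.map fun ρ => h ρ + h (r ρ)).sum := by
  rw [Multiset.sum_map_add, two_mul]
  congr 1
  conv_lhs => rw [← hZ, Multiset.map_map]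
  rfl

/-! ### Entire functions with a symmetric functional equation -/

section FunctionalEquation

variable {f : ℂ → ℂ} {W : ℂ}

/-- Differentiating the functional equation at a fixed point of the reflection gives f'/f =
-conj(f'/f). -/
theorem re_logDeriv_eq_zero_of_functional_equation (hf : Differentiable ℂ f)
    (hFE : ∀ s, f (criticalReflection s) = W * conj (f s)) {w : ℂ} (hw : w.re = 1 / 2)
    (hfw : f w ≠ 0) : (logDeriv f w).re = 0 := by
  have hww := criticalReflection_eq_self hw
  have h1 : f w = W * conj (f w) := by rw [← hFE, hww]
  have h2 : HasDerivAt (fun s => f (1 - s)) (-deriv f w) (conj w) := by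
    have : HasDerivAt f (deriv f w) (1 - conj w) := by
      rw [show 1 - conj w = w from hww]; exact (hf w).hasDerivAt
    simpa using this.comp_const_sub 1 (conj w)
  have h3 : HasDerivAt (fun s => W * (conj ∘ f ∘ conj) s) (W * conj (deriv f w)) (conj w) :=
    ((hf w).hasDerivAt.conj_conj).const_mul W
  have h4 : (fun s => f (1 - s)) = fun s => W * (conj ∘ f ∘ conj) s := by
    ext s
    have := hFE (conj s)
    simpa [criticalReflection] using this
  rw [h4] at h2
  have h5 := h2.unique h3
  have hcf : conj (f w) ≠ 0 := by simpa using hfw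
  have h6 : logDeriv f w = -conj (logDeriv f w) := by
    have hW : W ≠ 0 := fun h => hfw (by rw [h1, h, zero_mul])
    rw [logDeriv_apply, map_div₀, ← neg_div, div_eq_div_iff hfw hcf]
    nth_rewrite 2 [h1]
    linear_combination (-conj (f w)) * h5
  have := congrArg re h6
  simp only [neg_re, conj_re] at this
  linarith

/-- Reflecting the factorisation gives another one, with zeros `Z.map criticalReflection` and a
cofactor that is also zero-free on the disc, since the disc is centred on the critical line. Both
multisets therefore count orders of `f`. -/
theorem map_criticalReflection_eq (hFE : ∀ s, f (criticalReflection s) = W * conj (f s))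
    (hW : W ≠ 0)
    {g : ℂ → ℂ} {Z : Multiset ℂ} (hg : Differentiable ℂ g)
    (hfg : ∀ s, f s = (Z.map (s - ·)).prod * g s) {w : ℂ} (hw : w.re = 1 / 2) {R : ℝ}
    (hZ : ∀ ρ ∈ Z, ρ ∈ closedBall w R) (hg0 : ∀ s ∈ closedBall w R, g s ≠ 0) :
    Z.map criticalReflection = Z := by
  classical
  have hball : ∀ s ∈ closedBall w R, criticalReflection s ∈ closedBall w R := fun s hs => by
    rw [mem_closedBall, dist_eq_norm, norm_sub_rev] at *
    rw [sub_criticalReflection, criticalReflection_eq_self hw, norm_neg, norm_conj]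
    exact hs
  set g' : ℂ → ℂ := fun s => W * (-1) ^ Z.card * (conj ∘ g ∘ conj) (1 - s)
  have hg' : Differentiable ℂ g' := by
    have : Differentiable ℂ (conj ∘ g ∘ conj) := fun s => by
      have := (hg (conj s)).hasDerivAt.conj_conj
      rw [conj_conj] at this
      exact this.differentiableAt
    exact (this.comp (by fun_prop : Differentiable ℂ fun s : ℂ => 1 - s)).const_mul _
  have hg'0 : ∀ s ∈ closedBall w R, g' s ≠ 0 := fun s hs => by
    have := hg0 _ (hball s hs)
    simpa [g', hW, criticalReflection] using this
  have hfg' : ∀ s, f s = ((Z.map criticalReflection).map (s - ·)).prod * g' s := fun s => by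
    have h1 := hFE (criticalReflection s)
    rw [criticalReflection_involutive s, hfg (criticalReflection s)] at h1
    have h2 : ((-1 : ℂ) ^ Z.card) * (-1) ^ Z.card = 1 := by rw [← mul_pow]; norm_num
    rw [multiset_prod_sub_criticalReflection, h1]
    simp only [g', Function.comp_apply, map_mul, map_sub, map_one, criticalReflection]
    linear_combination (-W * conj (Multiset.map (fun x => 1 - conj s - x) Z).prod *
      conj (g (1 - conj s))) * h2
  ext ρ
  by_cases hρ : ρ ∈ closedBall w R
  · have h1 := count_eq_analyticOrderAt hg' hfg' (hg'0 ρ hρ)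
    rw [← count_eq_analyticOrderAt hg hfg (hg0 ρ hρ)] at h1
    exact_mod_cast h1
  · rw [Multiset.count_eq_zero_of_notMem (fun h => hρ (hZ ρ h)), Multiset.count_eq_zero_of_notMem]
    intro h
    obtain ⟨σ, hσ, rfl⟩ := Multiset.mem_map.mp h
    exact hρ (hball σ (hZ σ hσ))

theorem analyticOrderAt_criticalReflection (hf : Differentiable ℂ f)
    (hFE : ∀ s, f (criticalReflection s) = W * conj (f s)) (hW : W ≠ 0) {w : ℂ} (hw : f w ≠ 0)
    (hwre : w.re = 1 / 2) (ρ : ℂ) :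
    analyticOrderAt f (criticalReflection ρ) = analyticOrderAt f ρ := by
  classical
  obtain ⟨Z, g, hg, hZ, hg0, hfg⟩ := hf.exists_eq_multiset_prod_mul hw
    (isCompact_closedBall w (dist ρ w))
  have hsymm := map_criticalReflection_eq hFE hW hg hfg hwre (fun σ hσ => (hZ σ hσ).1) hg0
  have hρ : ρ ∈ closedBall w (dist ρ w) := by simp
  have hρ' : criticalReflection ρ ∈ closedBall w (dist ρ w) := by
    rw [mem_closedBall, dist_eq_norm, dist_eq_norm, norm_sub_rev, sub_criticalReflection,
      criticalReflection_eq_self hwre, norm_neg, norm_conj, norm_sub_rev]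
  rw [← count_eq_analyticOrderAt hg hfg (hg0 _ hρ), ← count_eq_analyticOrderAt hg hfg (hg0 _ hρ'),
    ← Multiset.count_map_eq_count' _ Z criticalReflection_involutive.injective ρ, hsymm]

theorem exists_re_eq_half_ne_zero (hf : Differentiable ℂ f) {z : ℂ} (hz : f z ≠ 0) :
    ∃ w : ℂ, w.re = 1 / 2 ∧ f w ≠ 0 := by
  by_contra! h
  have hfin := hf.finite_zeros_inter hz (isCompact_closedBall (1 / 2 : ℂ) 1)
  have hinj : Function.Injective fun t : ℝ => (1 / 2 : ℂ) + t * I := fun a b hab => by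
    simpa using hab
  refine (Icc_infinite (zero_lt_one' ℝ)) (Set.Finite.of_finite_image
    (f := fun t : ℝ => (1 / 2 : ℂ) + t * I) (hfin.subset ?_) hinj.injOn)
  rintro _ ⟨t, ht, rfl⟩
  refine ⟨?_, h _ (by simp)⟩
  simp [dist_eq_norm, abs_of_nonneg ht.1, ht.2]

/-- **Stechkin's trick** for a finite family of zeros: the logarithmic derivatives at `1` and at
the golden ratio dominate the contribution of the family. -/
theorem sum_re_one_div_one_sub_le (hf : Differentiable ℂ f) {C : ℝ}
    (hC : ∀ s, ‖f s‖ ≤ Real.exp (C * (1 + ‖s‖) ^ (3 / 2 : ℝ)))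
    (hFE : ∀ s, f (criticalReflection s) = W * conj (f s)) (hW : W ≠ 0)
    (hstrip : ∀ s, f s = 0 → 0 < s.re ∧ s.re < 1) {S : Multiset ℂ}
    (hS : ∀ ρ ∈ S, f ρ = 0 ∧ (S.count ρ : ℕ∞) ≤ analyticOrderAt f ρ) :
    (S.map fun ρ => (1 / (1 - ρ)).re).sum - S.card ≤
      (logDeriv f 1).re - 1 / √5 * (logDeriv f Real.goldenRatio).re := by
  classical
  have hf1 : f 1 ≠ 0 := fun h => by simpa using (hstrip 1 h).2
  have hfφ : f Real.goldenRatio ≠ 0 := fun h => by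
    have := (hstrip _ h).2
    rw [ofReal_re] at this
    linarith [Real.one_lt_goldenRatio]
  obtain ⟨w, hw, hfw⟩ := exists_re_eq_half_ne_zero hf hf1
  -- The union takes maxima of multiplicities; a sum could exceed the order of `f` at a zero whose
  -- reflection is also in `S`.
  set T := S ∪ S.map criticalReflection
  have hzero : ∀ ρ, f ρ = 0 → f (criticalReflection ρ) = 0 := fun ρ h => by rw [hFE, h]; simp
  have hT0 : ∀ ρ ∈ T, f ρ = 0 := fun ρ hρ => by
    rcases Multiset.mem_union.mp hρ with h | h
    · exact (hS ρ h).1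
    · obtain ⟨σ, hσ, rfl⟩ := Multiset.mem_map.mp h
      exact hzero σ (hS σ hσ).1
  have hle : ∀ ρ, (S.count ρ : ℕ∞) ≤ analyticOrderAt f ρ := fun ρ => by
    by_cases h : ρ ∈ S
    · exact (hS ρ h).2
    · simp [Multiset.count_eq_zero_of_notMem h]
  have hTle : ∀ ρ, (T.count ρ : ℕ∞) ≤ analyticOrderAt f ρ := fun ρ => by
    rw [Multiset.count_union]
    have h2 : ((S.map criticalReflection).count ρ : ℕ∞) ≤ analyticOrderAt f ρ := by
      rw [← criticalReflection_involutive ρ,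
        Multiset.count_map_eq_count' _ S criticalReflection_involutive.injective,
        analyticOrderAt_criticalReflection hf hFE hW hfw hw]
      exact hle _
    rcases max_cases (S.count ρ) ((S.map criticalReflection).count ρ) with h | h
    · rw [h.1]; exact hle ρ
    · rw [h.1]; exact h2
  have hTsymm : T.map criticalReflection = T := by
    ext ρ
    rw [Multiset.map_union criticalReflection_involutive.injective, Multiset.map_map,
      criticalReflection_involutive.comp_self, Multiset.map_id, Multiset.union_comm]
  have hTcard : (T.card : ℝ) ≤ 2 * S.card := by
    have := Multiset.card_le_card (Multiset.union_le_add S (S.map criticalReflection))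
    rw [Multiset.card_add, Multiset.card_map] at this
    exact_mod_cast this.trans_eq (two_mul _).symm
  refine le_of_forall_pos_le_add fun ε hε => ?_
  have hε' : 0 < ε / 2 := by positivity
  have hball : ∀ᶠ R : ℝ in atTop, ∀ ρ ∈ T.toFinset, dist ρ w ≤ R :=
    (Filter.eventually_all_finset _).mpr fun ρ _ => eventually_ge_atTop _
  obtain ⟨R, hR1, hRφ, hRT⟩ := ((eventually_norm_logDeriv_sub_le hC hfw 1 hε').and
    ((eventually_norm_logDeriv_sub_le hC hfw Real.goldenRatio hε').and hball)).exists
  obtain ⟨Z, g, hg, hZ, hg0, hfg⟩ := hf.exists_eq_multiset_prod_mul hfw (isCompact_closedBall w R)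
  have hZball := fun ρ hρ => (hZ ρ hρ).1
  have hZsymm := map_criticalReflection_eq hFE hW hg hfg hw hZball hg0
  have hTZ : T ≤ Z := Multiset.le_iff_count.mpr fun ρ => by
    by_cases h : ρ ∈ T
    · have := hTle ρ
      rw [← count_eq_analyticOrderAt hg hfg (hg0 ρ (hRT ρ (by simpa using h)))] at this
      exact_mod_cast this
    · simp [Multiset.count_eq_zero_of_notMem h]
  -- On the critical line the terms of ρ and its reflection have opposite real parts, so the sum
  -- over `Z` drops out.
  have hgw : (logDeriv g w).re = 0 := by
    have h1 := congrArg re (logDeriv_eq_sum_add_logDeriv hg hfg hfw)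
    rw [re_logDeriv_eq_zero_of_functional_equation hf hFE hw hfw, add_re,
      Multiset.re_sum_map] at h1
    have h2 := Multiset.two_mul_sum_map_of_map_eq hZsymm fun ρ => (1 / (w - ρ)).re
    have h3 : ∀ ρ, (1 / (w - ρ)).re + (1 / (w - criticalReflection ρ)).re = 0 := fun ρ => by
      rw [sub_criticalReflection, criticalReflection_eq_self hw, one_div_neg_eq_neg_one_div,
        neg_re, ← map_one (starRingEnd ℂ), ← map_div₀, conj_re, map_one, add_neg_cancel]
    simp only [h3, Multiset.map_const', Multiset.sum_replicate, smul_zero] at h2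
    linarith
  have hre : ∀ z : ℂ, f z ≠ 0 → ‖logDeriv g z - logDeriv g w‖ ≤ ε / 2 →
      |(logDeriv f z).re - (Z.map fun ρ => (1 / (z - ρ)).re).sum| ≤ ε / 2 := fun z hz hle => by
    have h1 := congrArg re (logDeriv_eq_sum_add_logDeriv hg hfg hz)
    rw [add_re, Multiset.re_sum_map] at h1
    have h2 := (abs_re_le_norm _).trans hle
    rw [sub_re, hgw, sub_zero] at h2
    rw [h1]
    simpa using h2
  have h1 := (abs_le.mp (hre 1 hf1 (hR1 Z g hg hfg hZball hg0))).1
  have h2 := (abs_le.mp (hre _ hfφ (hRφ Z g hg hfg hZball hg0))).2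
  have hκ0 : 0 < 1 / √5 := by positivity
  have hκ1 : 1 / √5 ≤ 1 := by
    rw [div_le_one (by positivity)]; exact Real.one_le_sqrt.mpr (by norm_num)
  set F : ℂ → ℝ := fun ρ => (1 / (1 - ρ)).re - 1 / √5 * (1 / ((Real.goldenRatio : ℂ) - ρ)).re
  have hZF : (Z.map F).sum = (Z.map fun ρ => (1 / (1 - ρ)).re).sum -
      1 / √5 * (Z.map fun ρ => (1 / ((Real.goldenRatio : ℂ) - ρ)).re).sum := by
    rw [← Multiset.sum_map_mul_left, ← Multiset.sum_map_sub]
  have hTF : (T.map F).sum = (T.map fun ρ => (1 / (1 - ρ)).re).sum -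
      1 / √5 * (T.map fun ρ => (1 / ((Real.goldenRatio : ℂ) - ρ)).re).sum := by
    rw [← Multiset.sum_map_mul_left, ← Multiset.sum_map_sub]
  -- Only F(ρ) plus F at the reflection is known to be nonnegative, so both sums are doubled and
  -- paired before zeros are discarded.
  have hmono : 2 * (T.map F).sum ≤ 2 * (Z.map F).sum := by
    rw [Multiset.two_mul_sum_map_of_map_eq hZsymm, Multiset.two_mul_sum_map_of_map_eq hTsymm]
    refine Multiset.sum_map_le_sum_map_of_le hTZ fun ρ hρ => ?_
    obtain ⟨h0, h1⟩ := hstrip ρ (hZ ρ hρ).2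
    have := stechkin_inequality h0 h1
    simp only [F]
    linarith
  have hTφ : 2 * (1 / √5 * (T.map fun ρ => (1 / ((Real.goldenRatio : ℂ) - ρ)).re).sum) ≤
      T.card := by
    rw [mul_left_comm, Multiset.two_mul_sum_map_of_map_eq hTsymm, ← Multiset.sum_map_mul_left]
    refine (Multiset.sum_le_card_nsmul _ 1 fun x hx => ?_).trans_eq (by simp)
    obtain ⟨ρ, hρ, rfl⟩ := Multiset.mem_map.mp hx
    obtain ⟨h0, h1⟩ := hstrip ρ (hT0 ρ hρ)
    exact re_one_div_goldenRatio_sub_pair_le h0 h1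
  have hST : (S.map fun ρ => (1 / (1 - ρ)).re).sum ≤ (T.map fun ρ => (1 / (1 - ρ)).re).sum :=
    Multiset.sum_map_le_sum_map_of_le Multiset.le_union_left fun ρ hρ =>
      (re_one_div_one_sub_pos (hstrip ρ (hT0 ρ hρ)).2).le
  have h2' := mul_le_mul_of_nonneg_left h2 hκ0.le
  have h3 : 1 / √5 * (ε / 2) ≤ ε / 2 := mul_le_of_le_one_left hε'.le hκ1
  linarith

end FunctionalEquation

/-! ### Growth of the gamma factors and of Mellin transforms -/

section Growth

open MeasureTheory

theorem Complex.norm_Gamma_le {s : ℂ} (hs : 0 < s.re) : ‖Gamma s‖ ≤ Real.Gamma s.re := by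
  rw [Gamma_eq_integral hs, Real.Gamma_eq_integral hs, GammaIntegral]
  refine (norm_integral_le_integral_norm _).trans_eq
    (setIntegral_congr_fun measurableSet_Ioi fun x (hx : 0 < x) => ?_)
  simp only [norm_mul, norm_real, norm_cpow_eq_rpow_re_of_pos hx, sub_re, one_re]
  rw [Real.norm_of_nonneg (Real.exp_pos _).le]

/-- Γ(x) ≤ ⌈x⌉! ≤ (1+x)^(1+x), and log(1+x) ≤ 2(1+x)^(1/2). Any exponent strictly between 1 and 2
would serve the partial fractions. -/
theorem Real.Gamma_le_exp_rpow {x : ℝ} (hx : 1 ≤ x) :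
    Real.Gamma x ≤ Real.exp (2 * (1 + x) ^ (3 / 2 : ℝ)) := by
  have h0 : 0 < x := by linarith
  have h1 : Real.Gamma x ≤ Real.Gamma (x + 1) := by
    rw [Real.Gamma_add_one h0.ne']
    exact le_mul_of_one_le_left (Real.Gamma_pos_of_pos h0).le hx
  have hceil := Nat.le_ceil x
  have h2 : Real.Gamma (x + 1) ≤ Real.Gamma (⌈x⌉₊ + 1) :=
    Real.Gamma_strictMonoOn_Ici.monotoneOn (by simp; linarith) (by simp; linarith) (by linarith)
  rw [Real.Gamma_nat_eq_factorial] at h2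
  have h3 : ((⌈x⌉₊).factorial : ℝ) ≤ (⌈x⌉₊ : ℝ) ^ ⌈x⌉₊ := by
    exact_mod_cast Nat.factorial_le_pow _
  have h4 : (⌈x⌉₊ : ℝ) ≤ 1 + x := by linarith [Nat.ceil_lt_add_one h0.le]
  have h5 : (⌈x⌉₊ : ℝ) ^ ⌈x⌉₊ ≤ (1 + x) ^ (1 + x) := by
    rw [← Real.rpow_natCast]
    exact (Real.rpow_le_rpow (by positivity) h4 (by positivity)).trans
      (Real.rpow_le_rpow_of_exponent_le (by linarith) h4)
  refine h1.trans (h2.trans (h3.trans (h5.trans ?_)))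
  rw [Real.rpow_def_of_pos (by linarith), Real.exp_le_exp]
  have h6 := Real.log_le_rpow_div (x := 1 + x) (ε := 1 / 2) (by linarith) (by norm_num)
  have h7 : (1 + x) ^ (3 / 2 : ℝ) = (1 + x) ^ (1 / 2 : ℝ) * (1 + x) := by
    rw [← Real.rpow_add_one (by linarith)]; norm_num
  rw [h7]
  have := mul_le_mul_of_nonneg_right h6 (by linarith : 0 ≤ 1 + x)
  linarith

theorem Complex.norm_Gammaℝ_le {s : ℂ} (hs : 2 ≤ s.re) :
    ‖Gammaℝ s‖ ≤ Real.exp (2 * (1 + ‖s‖) ^ (3 / 2 : ℝ)) := by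
  have e1 : (s / 2).re = s.re / 2 := by simp
  rw [Gammaℝ_def, norm_mul, norm_cpow_eq_rpow_re_of_pos Real.pi_pos]
  have h1 : Real.pi ^ (-s / 2).re ≤ 1 := by
    refine Real.rpow_le_one_of_one_le_of_nonpos (by linarith [Real.pi_gt_three]) ?_
    simp; linarith
  have h2 := norm_Gamma_le (s := s / 2) (by rw [e1]; linarith)
  have h3 := Real.Gamma_le_exp_rpow (x := (s / 2).re) (by rw [e1]; linarith)
  refine (mul_le_mul h1 (h2.trans h3) (norm_nonneg _) zero_le_one).trans ?_
  rw [one_mul, Real.exp_le_exp, e1]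
  have := re_le_norm s
  gcongr
  linarith

/-- In the Mellin integral, t^(Re s - 1) is at most t^(a-1) + t^(b-1), whichever side of 1 contains
t. -/
theorem WeakFEPair.exists_norm_Λ₀_le (P : WeakFEPair ℂ) (a b : ℝ) :
    ∃ B, ∀ s : ℂ, a ≤ s.re → s.re ≤ b → ‖P.Λ₀ s‖ ≤ B := by
  have hconv := fun s => (P.isStrongFEPair_toStrongFEPair.hasMellin s).1
  have hint : ∀ σ : ℝ, IntegrableOn (fun t : ℝ => t ^ (σ - 1) * ‖P.f_modif t‖) (Ioi 0) :=
      fun σ => by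
    refine IntegrableOn.congr_fun (hconv σ).norm (fun t (ht : 0 < t) => ?_) measurableSet_Ioi
    simp only [norm_smul, norm_cpow_eq_rpow_re_of_pos ht]
    simp [WeakFEPair.toStrongFEPair]
  refine ⟨∫ t in Ioi (0 : ℝ), (t ^ (a - 1) * ‖P.f_modif t‖ + t ^ (b - 1) * ‖P.f_modif t‖),
    fun s ha hb => ?_⟩
  refine (norm_integral_le_integral_norm _).trans
    (setIntegral_mono_on (hconv s).norm ((hint a).add (hint b)) measurableSet_Ioi
      fun t (ht : 0 < t) => ?_)
  rw [norm_smul, norm_cpow_eq_rpow_re_of_pos ht, sub_re, one_re, ← add_mul]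
  refine mul_le_mul_of_nonneg_right ?_ (norm_nonneg _)
  rcases le_total t 1 with h | h
  · exact (Real.rpow_le_rpow_of_exponent_ge ht h (by linarith)).trans
      (le_add_of_nonneg_right (by positivity))
  · exact (Real.rpow_le_rpow_of_exponent_le h (by linarith)).trans
      (le_add_of_nonneg_left (by positivity))

theorem exists_norm_completedHurwitzZetaEven₀_le (x : UnitAddCircle) (a b : ℝ) :
    ∃ B, ∀ s : ℂ, a ≤ s.re → s.re ≤ b → ‖HurwitzZeta.completedHurwitzZetaEven₀ x s‖ ≤ B := by
  obtain ⟨B, hB⟩ := (HurwitzZeta.hurwitzEvenFEPair x).exists_norm_Λ₀_le (a / 2) (b / 2)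
  refine ⟨B / 2, fun s ha hb => ?_⟩
  have e1 : (s / 2).re = s.re / 2 := by simp
  have := hB (s / 2) (by rw [e1]; linarith) (by rw [e1]; linarith)
  rw [HurwitzZeta.completedHurwitzZetaEven₀, norm_div, norm_ofNat]
  linarith

theorem exists_norm_completedHurwitzZetaOdd_le (x : UnitAddCircle) (a b : ℝ) :
    ∃ B, ∀ s : ℂ, a ≤ s.re → s.re ≤ b → ‖HurwitzZeta.completedHurwitzZetaOdd x s‖ ≤ B := by
  obtain ⟨B, hB⟩ :=
    (HurwitzZeta.hurwitzOddFEPair x).exists_norm_Λ₀_le ((a + 1) / 2) ((b + 1) / 2)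
  refine ⟨B / 2, fun s ha hb => ?_⟩
  have e1 : ((s + 1) / 2).re = (s.re + 1) / 2 := by simp
  have := hB ((s + 1) / 2) (by rw [e1]; linarith) (by rw [e1]; linarith)
  rw [WeakFEPair.Λ₀_eq, (HurwitzZeta.isStrong_hurwitzOddFEPair x).hf₀,
    (HurwitzZeta.isStrong_hurwitzOddFEPair x).hg₀, smul_zero, smul_zero, add_zero, add_zero] at this
  rw [HurwitzZeta.completedHurwitzZetaOdd, norm_div, norm_ofNat]
  linarith

end Growth

/-! ### The normalised completed L-function: functional equation and growth -/

namespace DirichletCharacter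

variable {q : ℕ} [NeZero q] {χ : DirichletCharacter ℂ q}

theorem IsPrimitive.ne_one (hχ : χ.IsPrimitive) (hq : 2 ≤ q) : χ ≠ 1 := by
  rintro rfl
  rw [isPrimitive_def, conductor_one] at hχ
  omega

theorem completedLFunction_eq_LFunction_mul_gammaFactor (hq : q ≠ 1) {s : ℂ} (hs : 0 < s.re) :
    completedLFunction χ s = χ.LFunction s * χ.gammaFactor s := by
  have hγ : χ.gammaFactor s ≠ 0 := by
    rw [gammaFactor]
    split_ifs
    · exact Gammaℝ_ne_zero_of_re_pos hs
    · exact Gammaℝ_ne_zero_of_re_pos (by simp; linarith)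
  rw [LFunction_eq_completed_div_gammaFactor χ s (Or.inr hq), div_mul_cancel₀ _ hγ]

/-- The polar terms have coefficients χ(0) and ∑ χ(j), both zero here; what remains is a finite sum
of bounded Hurwitz functions. -/
theorem exists_norm_completedLFunction_le_of_mem_strip (hχ : χ ≠ 1) {a b : ℝ} (ha : 0 ≤ a) :
    ∃ B, ∀ s : ℂ, a ≤ s.re → s.re ≤ b → ‖completedLFunction χ s‖ ≤ B := by
  have hq : q ≠ 1 := hχ ∘ level_one' _
  choose E hE using fun x : UnitAddCircle => exists_norm_completedHurwitzZetaEven₀_le x a b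
  choose O hO using fun x : UnitAddCircle => exists_norm_completedHurwitzZetaOdd_le x a b
  refine ⟨∑ j : ZMod q, ‖χ j‖ * E (ZMod.toAddCircle j) +
    ∑ j : ZMod q, ‖χ j‖ * O (ZMod.toAddCircle j), fun s h1 h2 => ?_⟩
  have hN : ‖(q : ℂ) ^ (-s)‖ ≤ 1 := by
    rw [norm_natCast_cpow_of_pos (NeZero.pos q)]
    refine Real.rpow_le_one_of_one_le_of_nonpos (by exact_mod_cast NeZero.one_le) ?_
    simp; linarith
  rw [completedLFunction, ZMod.completedLFunction_eq, χ.map_zero' hq, χ.sum_eq_zero_of_ne_one hχ]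
  simp only [mul_zero, zero_div, sub_zero]
  rw [ZMod.completedLFunction₀, ← mul_add, norm_mul]
  refine (mul_le_of_le_one_left (norm_nonneg _) hN).trans ((norm_add_le _ _).trans ?_)
  refine add_le_add ?_ ?_ <;> refine norm_sum_le_of_le _ fun j _ => ?_ <;> rw [norm_mul]
  · exact mul_le_mul_of_nonneg_left (hE _ s h1 h2) (norm_nonneg _)
  · exact mul_le_mul_of_nonneg_left (hO _ s h1 h2) (norm_nonneg _)

theorem exists_norm_LFunction_le (χ : DirichletCharacter ℂ q) :
    ∃ B, ∀ s : ℂ, 2 ≤ s.re → ‖χ.LFunction s‖ ≤ B := by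
  have hsum : LSeriesSummable (χ ·) 2 := (LSeriesSummable_iff (NeZero.ne q) χ).mpr (by simp)
  refine ⟨∑' n, ‖LSeries.term (χ ·) 2 n‖, fun s hs => ?_⟩
  rw [LFunction_eq_LSeries χ (by linarith)]
  exact tsum_of_norm_bounded hsum.norm.hasSum fun n =>
    LSeries.norm_term_le_of_re_le_re _ (by simpa using hs) n

theorem norm_gammaFactor_le {n : ℕ} (χ : DirichletCharacter ℂ n) {s : ℂ} (hs : 2 ≤ s.re) :
    ‖χ.gammaFactor s‖ ≤ Real.exp (2 * (2 + ‖s‖) ^ (3 / 2 : ℝ)) := by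
  rw [gammaFactor]
  split_ifs
  · refine (norm_Gammaℝ_le hs).trans (Real.exp_le_exp.mpr ?_)
    gcongr; norm_num
  · refine (norm_Gammaℝ_le (by simp; linarith)).trans (Real.exp_le_exp.mpr ?_)
    have := norm_add_le s 1
    rw [norm_one] at this
    gcongr 2 * ?_ ^ _
    linarith

theorem gammaFactor_inv {n : ℕ} (χ : DirichletCharacter ℂ n) : χ⁻¹.gammaFactor = χ.gammaFactor := by
  have h : χ⁻¹.Even ↔ χ.Even := by
    unfold Even
    rw [← MulChar.star_apply']
    constructor <;> intro h
    · simpa using congrArg star h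
    · rw [h, star_one]
  ext s
  by_cases h' : χ.Even
  · simp [gammaFactor, h', h.mpr h']
  · simp [gammaFactor, h', h.not.mpr h']

theorem _root_.Complex.Gammaℝ_conj (s : ℂ) : Gammaℝ (conj s) = conj (Gammaℝ s) := by
  rw [Gammaℝ_def, Gammaℝ_def, map_mul, ← Gamma_conj, map_div₀, map_ofNat,
    show -conj s / 2 = conj (-s / 2) by rw [map_div₀, map_neg, map_ofNat],
    cpow_conj _ _ (by rw [arg_ofReal_of_nonneg Real.pi_pos.le]; exact Real.pi_ne_zero.symm),
    conj_ofReal]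

theorem gammaFactor_conj {n : ℕ} (χ : DirichletCharacter ℂ n) (s : ℂ) :
    χ.gammaFactor (conj s) = conj (χ.gammaFactor s) := by
  simp only [gammaFactor]
  split_ifs
  · exact Gammaℝ_conj s
  · rw [← Gammaℝ_conj, map_add, map_one]

theorem natCast_cpow_conj (n : ℕ) (s : ℂ) : (n : ℂ) ^ conj s = conj ((n : ℂ) ^ s) := by
  rw [cpow_conj _ _ (by rw [natCast_arg]; exact Real.pi_ne_zero.symm), conj_natCast]

theorem LFunction_inv_conj_of_one_lt_re (χ : DirichletCharacter ℂ q) {s : ℂ} (hs : 1 < s.re) :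
    χ⁻¹.LFunction (conj s) = conj (χ.LFunction s) := by
  rw [LFunction_eq_LSeries _ (by simpa using hs), LFunction_eq_LSeries _ hs, LSeries, LSeries,
    conj_tsum]
  refine tsum_congr fun n => ?_
  rcases eq_or_ne n 0 with rfl | hn
  · simp
  · rw [LSeries.term_of_ne_zero hn, LSeries.term_of_ne_zero hn, map_div₀, natCast_cpow_conj,
      ← MulChar.star_apply', RCLike.star_def]

theorem completedLFunction_inv_conj (hχ : χ ≠ 1) (s : ℂ) :
    completedLFunction χ⁻¹ (conj s) = conj (completedLFunction χ s) := by
  have hq : q ≠ 1 := hχ ∘ level_one' _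
  have hχ' : χ⁻¹ ≠ 1 := by simpa using hχ
  have h1 : Differentiable ℂ (conj ∘ completedLFunction χ⁻¹ ∘ conj) := fun s => by
    have := (differentiable_completedLFunction hχ' (conj s)).hasDerivAt.conj_conj
    rw [conj_conj] at this
    exact this.differentiableAt
  have h2 := AnalyticOnNhd.eqOn_of_preconnected_of_eventuallyEq (𝕜 := ℂ) (U := univ) (z₀ := 2)
    (fun z _ => h1.analyticAt z) (fun z _ => (differentiable_completedLFunction hχ).analyticAt z)
    isPreconnected_univ (mem_univ _) (by
      filter_upwards [(isOpen_lt continuous_const continuous_re).mem_nhds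
        (by simp : (1 : ℝ) < (2 : ℂ).re)] with z (hz : 1 < z.re)
      have hz0 : 0 < z.re := by linarith
      rw [Function.comp_apply, Function.comp_apply,
        completedLFunction_eq_LFunction_mul_gammaFactor hq (by simpa using hz0),
        completedLFunction_eq_LFunction_mul_gammaFactor hq hz0,
        LFunction_inv_conj_of_one_lt_re _ hz, gammaFactor_inv, gammaFactor_conj, map_mul, conj_conj,
        conj_conj])
  have h3 := h2 (mem_univ s)
  rw [← h3, Function.comp_apply, Function.comp_apply, conj_conj]

/-- The completed `L`-function, normalised so as to have a symmetric functional equation. -/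
noncomputable def normalizedLFunction (χ : DirichletCharacter ℂ q) (s : ℂ) : ℂ :=
  (q : ℂ) ^ (s / 2) * completedLFunction χ s

theorem differentiable_normalizedLFunction (hχ : χ ≠ 1) :
    Differentiable ℂ χ.normalizedLFunction := by
  have : Differentiable ℂ fun s : ℂ => (q : ℂ) ^ (s / 2) := by fun_prop
  exact this.mul (differentiable_completedLFunction hχ)

theorem IsPrimitive.normalizedLFunction_criticalReflection (hχ : χ.IsPrimitive) (h1 : χ ≠ 1)
    (s : ℂ) : χ.normalizedLFunction (criticalReflection s) =
      rootNumber χ * conj (χ.normalizedLFunction s) := by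
  have hq : (q : ℂ) ≠ 0 := NeZero.ne _
  rw [normalizedLFunction, normalizedLFunction, criticalReflection,
    hχ.completedLFunction_one_sub, completedLFunction_inv_conj h1, map_mul, ← natCast_cpow_conj,
    ← mul_assoc, ← mul_assoc, ← cpow_add _ _ hq]
  rw [show (1 - conj s) / 2 + (conj s - 1 / 2) = conj (s / 2) by
    rw [map_div₀, map_ofNat]; ring]
  ring

/-- For Re s ≥ 0, combine boundedness in the strip 0 ≤ Re s ≤ 2 with the Dirichlet series and gamma
bounds beyond it; the functional equation covers Re s ≤ 0. -/
theorem exists_norm_normalizedLFunction_le (hχ : χ.IsPrimitive) (h1 : χ ≠ 1) :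
    ∃ C, ∀ s, ‖χ.normalizedLFunction s‖ ≤ Real.exp (C * (1 + ‖s‖) ^ (3 / 2 : ℝ)) := by
  have hq : q ≠ 1 := h1 ∘ level_one' _
  obtain ⟨B₁, hB₁⟩ := exists_norm_completedLFunction_le_of_mem_strip h1 (b := 2) (le_refl 0)
  obtain ⟨B₂, hB₂⟩ := exists_norm_LFunction_le χ
  have hone : ∀ s : ℂ, 1 ≤ (2 + ‖s‖) ^ (3 / 2 : ℝ) := fun s =>
    Real.one_le_rpow (by linarith [norm_nonneg s]) (by norm_num)
  have hself : ∀ s : ℂ, ‖s‖ ≤ (2 + ‖s‖) ^ (3 / 2 : ℝ) := fun s => by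
    have := Real.rpow_le_rpow_of_exponent_le (x := 2 + ‖s‖) (y := 1) (z := 3 / 2)
      (by linarith [norm_nonneg s]) (by norm_num)
    rw [Real.rpow_one] at this
    linarith
  have hexp : ∀ B x : ℝ, 1 ≤ x → B ≤ Real.exp (|B| * x) := fun B x hx => by
    have h2 := Real.add_one_le_exp (|B| * x)
    have h3 := le_mul_of_one_le_right (abs_nonneg B) hx
    linarith [le_abs_self B]
  have hN : ∀ s : ℂ, ‖(q : ℂ) ^ (s / 2)‖ ≤ Real.exp (Real.log q * (2 + ‖s‖) ^ (3 / 2 : ℝ)) :=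
      fun s => by
    have hlog : 0 ≤ Real.log q := Real.log_natCast_nonneg q
    have h2 : s.re / 2 ≤ ‖s‖ := by linarith [re_le_norm s, norm_nonneg s]
    rw [norm_natCast_cpow_of_pos (NeZero.pos q),
      Real.rpow_def_of_pos (by exact_mod_cast NeZero.pos q), Real.exp_le_exp]
    refine mul_le_mul_of_nonneg_left ?_ hlog
    simpa using h2.trans (hself s)
  set K := |B₁| + |B₂| + 2 + Real.log q
  have hright : ∀ s : ℂ, 0 ≤ s.re →
      ‖χ.normalizedLFunction s‖ ≤ Real.exp (K * (2 + ‖s‖) ^ (3 / 2 : ℝ)) := fun s hs => by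
    have hX := hone s
    have hNs := hN s
    set X := (2 + ‖s‖) ^ (3 / 2 : ℝ)
    rw [normalizedLFunction, norm_mul]
    rcases le_total s.re 2 with h | h
    · refine (mul_le_mul hNs ((hB₁ s hs h).trans (hexp _ _ hX)) (norm_nonneg _)
        (Real.exp_pos _).le).trans ?_
      rw [← Real.exp_add, Real.exp_le_exp]
      have : 0 ≤ |B₂| * X := by positivity
      simp only [K]; linarith
    · rw [completedLFunction_eq_LFunction_mul_gammaFactor hq (by linarith), norm_mul]
      refine (mul_le_mul hNs (mul_le_mul ((hB₂ s h).trans (hexp _ _ hX)) (norm_gammaFactor_le χ h)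
        (norm_nonneg _) (Real.exp_pos _).le) (by positivity) (Real.exp_pos _).le).trans ?_
      rw [← Real.exp_add, ← Real.exp_add, Real.exp_le_exp]
      have : 0 ≤ |B₁| * X := by positivity
      simp only [K]; linarith
  have hK : 0 ≤ K := by have := Real.log_natCast_nonneg q; positivity
  -- The size of the root number is absorbed into the constant, so |W| = 1 is not needed.
  set w := |‖rootNumber χ‖|
  have hcomp : ∀ s : ℂ, (3 + ‖s‖) ^ (3 / 2 : ℝ) ≤ 3 ^ (3 / 2 : ℝ) * (1 + ‖s‖) ^ (3 / 2 : ℝ) :=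
      fun s => by
    rw [← Real.mul_rpow (by norm_num) (by positivity)]
    exact Real.rpow_le_rpow (by positivity) (by linarith [norm_nonneg s]) (by norm_num)
  refine ⟨(K + w) * 3 ^ (3 / 2 : ℝ), fun s => ?_⟩
  have hmono : (2 + ‖s‖) ^ (3 / 2 : ℝ) ≤ (3 + ‖s‖) ^ (3 / 2 : ℝ) := by gcongr; norm_num
  have hKw := mul_le_mul_of_nonneg_left (hcomp s) (by positivity : 0 ≤ K + w)
  rw [← mul_assoc] at hKw
  rcases le_total 0 s.re with h | h
  · refine (hright s h).trans (Real.exp_le_exp.mpr (le_trans ?_ hKw))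
    have hw : 0 ≤ w * (3 + ‖s‖) ^ (3 / 2 : ℝ) := by positivity
    have := mul_le_mul_of_nonneg_left hmono hK
    linarith
  · have hr := hright (criticalReflection s) (by simp [criticalReflection]; linarith)
    have hnorm : 2 + ‖criticalReflection s‖ ≤ 3 + ‖s‖ := by
      have := norm_sub_le 1 (conj s)
      rw [norm_one, norm_conj] at this
      rw [criticalReflection]; linarith
    have hmono' := Real.rpow_le_rpow (by positivity) hnorm (by norm_num : (0 : ℝ) ≤ 3 / 2)
    have h3 := (hone s).trans hmono
    rw [← criticalReflection_involutive s, hχ.normalizedLFunction_criticalReflection h1, norm_mul,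
      norm_conj, criticalReflection_involutive s]
    refine (mul_le_mul (hexp _ _ h3) hr (norm_nonneg _) (Real.exp_pos _).le).trans ?_
    rw [← Real.exp_add, Real.exp_le_exp]
    refine le_trans ?_ hKw
    have := mul_le_mul_of_nonneg_left hmono' hK
    linarith

end DirichletCharacter

/-! ### The digamma function and the gamma factors -/

section Digamma

theorem Complex.differentiableAt_Gamma_of_re_pos {s : ℂ} (hs : 0 < s.re) :
    DifferentiableAt ℂ Complex.Gamma s :=
  Complex.differentiableAt_Gamma s fun m h => by
    have := congrArg re h
    simp only [neg_re, natCast_re] at this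
    linarith [m.cast_nonneg (α := ℝ)]

theorem Real.differentiableAt_Gamma_of_pos {x : ℝ} (hx : 0 < x) :
    DifferentiableAt ℝ Real.Gamma x :=
  (Complex.differentiableAt_Gamma_of_re_pos
    (by simpa using hx)).hasDerivAt.real_of_complex.differentiableAt

theorem Real.monotoneOn_logDeriv_Gamma : MonotoneOn (logDeriv Real.Gamma) (Ioi 0) := by
  have hd : ∀ x ∈ Ioi (0 : ℝ), DifferentiableAt ℝ (Real.log ∘ Real.Gamma) x := fun x hx =>
    (Real.differentiableAt_Gamma_of_pos hx).log (Real.Gamma_pos_of_pos hx).ne'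
  have h := Real.convexOn_log_Gamma.monotoneOn_deriv hd
  refine h.congr fun x hx => ?_
  exact deriv.log (Real.differentiableAt_Gamma_of_pos hx) (Real.Gamma_pos_of_pos hx).ne'

theorem Real.logDeriv_Gamma_one_half_le : logDeriv Real.Gamma (1 / 2) ≤ 0 := by
  rw [logDeriv_apply, Real.hasDerivAt_Gamma_one_half.deriv]
  refine div_nonpos_of_nonpos_of_nonneg ?_ (Real.Gamma_pos_of_pos (by norm_num)).le
  have h1 := Real.one_half_lt_eulerMascheroniConstant
  have h2 := Real.log_pos one_lt_two
  have h3 : 0 ≤ √Real.pi * (Real.eulerMascheroniConstant + 2 * Real.log 2) := by positivity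
  linarith

theorem Real.logDeriv_Gamma_one_le : logDeriv Real.Gamma 1 ≤ 0 := by
  rw [logDeriv_apply, Real.hasDerivAt_Gamma_one.deriv, Real.Gamma_one, div_one]
  linarith [Real.one_half_lt_eulerMascheroniConstant]

theorem Complex.re_logDeriv_Gamma_ofReal {x : ℝ} (hx : 0 < x) :
    (logDeriv Complex.Gamma x).re = logDeriv Real.Gamma x := by
  have h1 : DifferentiableAt ℂ Complex.Gamma x :=
    Complex.differentiableAt_Gamma_of_re_pos (by simpa using hx)
  have h2 : deriv Real.Gamma x = (deriv Complex.Gamma x).re := h1.hasDerivAt.real_of_complex.deriv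
  rw [logDeriv_apply, logDeriv_apply, Complex.Gamma_ofReal, div_ofReal_re, h2]

theorem Complex.differentiableAt_Gammaℝ {s : ℂ} (hs : 0 < s.re) : DifferentiableAt ℂ Gammaℝ s := by
  have h1 : DifferentiableAt ℂ Complex.Gamma (s / 2) :=
    Complex.differentiableAt_Gamma_of_re_pos (by simpa using hs)
  have h2 : DifferentiableAt ℂ (fun s : ℂ => (Real.pi : ℂ) ^ (-s / 2)) s :=
    DifferentiableAt.const_cpow (by fun_prop) (Or.inl (by simp [Real.pi_ne_zero]))
  exact h2.mul (h1.comp s (by fun_prop))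

theorem Complex.re_logDeriv_Gammaℝ_ofReal {x : ℝ} (hx : 0 < x) :
    (logDeriv Gammaℝ x).re = -(1 / 2) * Real.log Real.pi + 1 / 2 * logDeriv Real.Gamma (x / 2) := by
  have hx2 : 0 < x / 2 := by positivity
  have h1 : DifferentiableAt ℂ Complex.Gamma ((x : ℂ) / 2) :=
    Complex.differentiableAt_Gamma_of_re_pos (by simpa using hx)
  have hπ : (Real.pi : ℂ) ≠ 0 := by simp [Real.pi_ne_zero]
  have h2 : HasDerivAt (fun s : ℂ => (Real.pi : ℂ) ^ (-s / 2))
      ((Real.pi : ℂ) ^ (-(x : ℂ) / 2) * Complex.log Real.pi * (-1 / 2)) x :=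
    HasDerivAt.const_cpow (((hasDerivAt_id _).neg).div_const 2) (Or.inl hπ)
  have h3 : HasDerivAt (fun s : ℂ => Complex.Gamma (s / 2))
      (deriv Complex.Gamma ((x : ℂ) / 2) * (1 / 2)) x :=
    h1.hasDerivAt.comp (x : ℂ) ((hasDerivAt_id (x : ℂ)).div_const 2)
  have hp : (Real.pi : ℂ) ^ (-(x : ℂ) / 2) ≠ 0 := by simp [hπ]
  have hg : Complex.Gamma ((x : ℂ) / 2) ≠ 0 :=
    Complex.Gamma_ne_zero_of_re_pos (by simpa using hx)
  have h4 : logDeriv Gammaℝ x =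
      ((-(1 / 2) * Real.log Real.pi : ℝ) : ℂ) +
        ((1 / 2 : ℝ) : ℂ) * logDeriv Complex.Gamma ((x / 2 : ℝ) : ℂ) := by
    rw [show Gammaℝ = (fun s : ℂ => (Real.pi : ℂ) ^ (-s / 2)) * fun s => Complex.Gamma (s / 2)
      from funext Gammaℝ_def]
    rw [Pi.mul_def, logDeriv_mul (x : ℂ) hp hg h2.differentiableAt h3.differentiableAt, logDeriv_apply,
      logDeriv_apply, h2.deriv, h3.deriv, logDeriv_apply]
    push_cast
    rw [Complex.ofReal_log Real.pi_pos.le]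
    field_simp
  rw [h4, add_re, ofReal_re, re_ofReal_mul, re_logDeriv_Gamma_ofReal hx2]

theorem logDeriv_gammaFactor {n : ℕ} (χ : DirichletCharacter ℂ n) :
    (∀ s, logDeriv χ.gammaFactor s = logDeriv Gammaℝ s) ∨
      ∀ s, logDeriv χ.gammaFactor s = logDeriv Gammaℝ (s + 1) := by
  rcases χ.even_or_odd with h | h
  · exact Or.inl fun s => by rw [show χ.gammaFactor = Gammaℝ from funext h.gammaFactor_def]
  · refine Or.inr fun s => ?_
    rw [show χ.gammaFactor = fun s => Gammaℝ (s + 1) from funext h.gammaFactor_def, logDeriv_apply,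
      logDeriv_apply, deriv_comp_add_const]

/-- Let ψ = Γ'/Γ, which increases by log-convexity of Γ. Then ψ(x/2) - κψ(y/2) ≤ (1-κ)ψ(x/2) ≤ 0,
with x = 1 for even χ and x = 2 for odd χ. Only the powers of π remain. -/
theorem re_logDeriv_gammaFactor_sub_le {n : ℕ} (χ : DirichletCharacter ℂ n) {κ φ : ℝ}
    (h0 : 0 ≤ κ) (h1 : κ ≤ 1) (hφ : 1 ≤ φ) :
    (logDeriv χ.gammaFactor 1).re - κ * (logDeriv χ.gammaFactor φ).re ≤
      -((1 - κ) / 2) * Real.log Real.pi := by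
  have key : ∀ x y : ℝ, 0 < x → x ≤ y → logDeriv Real.Gamma (x / 2) ≤ 0 →
      (logDeriv Gammaℝ x).re - κ * (logDeriv Gammaℝ y).re ≤
        -((1 - κ) / 2) * Real.log Real.pi := fun x y hx hxy hneg => by
    rw [Complex.re_logDeriv_Gammaℝ_ofReal hx, Complex.re_logDeriv_Gammaℝ_ofReal (by linarith)]
    have := Real.monotoneOn_logDeriv_Gamma (show x / 2 ∈ Ioi 0 by simp [hx])
      (show y / 2 ∈ Ioi 0 by simp; linarith) (by linarith)
    have h2 := mul_le_mul_of_nonneg_left this h0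
    have h3 := mul_nonpos_of_nonneg_of_nonpos (sub_nonneg.mpr h1) hneg
    linarith
  rcases logDeriv_gammaFactor χ with h | h <;> rw [h, h]
  · exact_mod_cast key 1 φ one_pos hφ Real.logDeriv_Gamma_one_half_le
  · have := key (1 + 1) (φ + 1) (by norm_num) (by linarith)
      (by norm_num; exact Real.logDeriv_Gamma_one_le)
    push_cast at this
    exact this

end Digamma

/-! ### A numerical bound for L'/L on Re s ≥ 8/5 -/

section Dirichlet

theorem hasDerivAt_rpow_mul_log_add {x : ℝ} (hx : 0 < x) :
    HasDerivAt (fun x : ℝ => -(x ^ (-(3 / 5) : ℝ) * (5 / 3 * Real.log x + 25 / 9)))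
      (Real.log x / x ^ (8 / 5 : ℝ)) x := by
  have h1 := Real.hasDerivAt_rpow_const (x := x) (p := -(3 / 5)) (Or.inl hx.ne')
  have h2 := ((Real.hasDerivAt_log hx.ne').const_mul (5 / 3)).add_const (25 / 9)
  refine (h1.mul h2).neg.congr_deriv ?_
  have e1 : x ^ (-(3 / 5) - 1 : ℝ) = (x ^ (8 / 5 : ℝ))⁻¹ := by
    rw [← Real.rpow_neg hx.le]; norm_num
  have e2 : x ^ (-(3 / 5) : ℝ) = (x ^ (8 / 5 : ℝ))⁻¹ * x := by
    rw [← e1, ← Real.rpow_add_one hx.ne']; norm_num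
  rw [e1, e2]
  field_simp
  ring

/-- One step of the integral comparison for log x / x^(8/5), which decreases beyond e^(5/8) < 2. -/
theorem log_add_one_div_rpow_le {x : ℝ} (hx : 2 ≤ x) :
    Real.log (x + 1) / (x + 1) ^ (8 / 5 : ℝ) ≤
      x ^ (-(3 / 5) : ℝ) * (5 / 3 * Real.log x + 25 / 9) -
        (x + 1) ^ (-(3 / 5) : ℝ) * (5 / 3 * Real.log (x + 1) + 25 / 9) := by
  obtain ⟨c, hc, hcs⟩ := exists_hasDerivAt_eq_slope
    (fun x : ℝ => -(x ^ (-(3 / 5) : ℝ) * (5 / 3 * Real.log x + 25 / 9)))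
    (fun x => Real.log x / x ^ (8 / 5 : ℝ)) (lt_add_one x)
    (fun y hy => (hasDerivAt_rpow_mul_log_add
      (by linarith [hy.1] : 0 < y)).continuousAt.continuousWithinAt)
    (fun y hy => hasDerivAt_rpow_mul_log_add (by linarith [hy.1]))
  rw [add_sub_cancel_left, div_one] at hcs
  have hexp : Real.exp (8 / 5)⁻¹ ≤ 2 := by
    rw [← Real.le_log_iff_exp_le two_pos]; linarith [Real.log_two_gt_d9]
  have hanti := Real.log_div_self_rpow_antitoneOn (a := 8 / 5) (by norm_num)
    (show c ∈ Ici (Real.exp (8 / 5)⁻¹) from hexp.trans (by linarith [hc.1]))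
    (show x + 1 ∈ Ici (Real.exp (8 / 5)⁻¹) from hexp.trans (by linarith)) hc.2.le
  simp only at hanti
  linarith

/-- The term at 2 is at most 7/20. The terms from 3 on are at most the integral from 2, hence at
most the integral from 1, which is 25/9; and 7/20 + 25/9 < 63/20. -/
theorem sum_range_log_div_rpow_le (N : ℕ) :
    ∑ i ∈ Finset.range N, Real.log i / (i : ℝ) ^ (8 / 5 : ℝ) ≤ 63 / 20 := by
  have hnn : ∀ i : ℕ, 0 ≤ Real.log i / (i : ℝ) ^ (8 / 5 : ℝ) := fun i =>
    div_nonneg (Real.log_natCast_nonneg i) (by positivity)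
  have hind : ∀ N : ℕ, ∑ i ∈ Finset.range (N + 3), Real.log i / (i : ℝ) ^ (8 / 5 : ℝ) ≤
      Real.log 2 / 2 ^ (8 / 5 : ℝ) + 2 ^ (-(3 / 5) : ℝ) * (5 / 3 * Real.log 2 + 25 / 9) -
        (N + 2 : ℝ) ^ (-(3 / 5) : ℝ) * (5 / 3 * Real.log (N + 2) + 25 / 9) := fun N => by
    induction N with
    | zero => simp [Finset.sum_range_succ]
    | succ N ih =>
      have := log_add_one_div_rpow_le (x := N + 2) (by linarith [N.cast_nonneg (α := ℝ)])
      rw [show N + 1 + 3 = (N + 3) + 1 by ring, Finset.sum_range_succ]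
      push_cast at this ⊢
      rw [show (N : ℝ) + 2 + 1 = N + 3 by ring] at this
      rw [show (N : ℝ) + 1 + 2 = N + 3 by ring]
      linarith
  have h1 : Real.log 2 / 2 ^ (8 / 5 : ℝ) ≤ 7 / 20 := by
    have h2 : (2 : ℝ) ≤ 2 ^ (8 / 5 : ℝ) :=
      (Real.rpow_one 2).symm.le.trans (Real.rpow_le_rpow_of_exponent_le one_le_two (by norm_num))
    rw [div_le_iff₀ (by positivity)]
    linarith [Real.log_two_lt_d9]
  have h2 : (2 : ℝ) ^ (-(3 / 5) : ℝ) * (5 / 3 * Real.log 2 + 25 / 9) ≤ 25 / 9 := by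
    have hmono : MonotoneOn (fun x : ℝ => -(x ^ (-(3 / 5) : ℝ) * (5 / 3 * Real.log x + 25 / 9)))
        (Icc 1 2) := by
      refine monotoneOn_of_deriv_nonneg (convex_Icc 1 2) (fun y hy => ?_) (fun y hy => ?_)
        (fun y hy => ?_)
      · exact (hasDerivAt_rpow_mul_log_add
          (by linarith [hy.1] : 0 < y)).continuousAt.continuousWithinAt
      · rw [interior_Icc] at hy
        exact (hasDerivAt_rpow_mul_log_add
          (by linarith [hy.1] : 0 < y)).differentiableAt.differentiableWithinAt
      · rw [interior_Icc] at hy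
        have hy0 : 0 < y := by linarith [hy.1]
        rw [(hasDerivAt_rpow_mul_log_add hy0).deriv]
        exact div_nonneg (Real.log_nonneg hy.1.le) (by positivity)
    have := hmono (left_mem_Icc.mpr one_le_two) (right_mem_Icc.mpr one_le_two) one_le_two
    simp only [Real.one_rpow, Real.log_one] at this
    linarith
  refine (Finset.sum_le_sum_of_subset_of_nonneg
    (Finset.range_mono (show N ≤ N + 3 by omega)) fun i _ _ => hnn i).trans ((hind N).trans ?_)
  have h3 : 0 ≤ (N + 2 : ℝ) ^ (-(3 / 5) : ℝ) * (5 / 3 * Real.log (N + 2) + 25 / 9) := by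
    have : 0 ≤ Real.log (N + 2) := Real.log_nonneg (by linarith [N.cast_nonneg (α := ℝ)])
    positivity
  linarith

namespace DirichletCharacter

variable {q : ℕ} [NeZero q] {χ : DirichletCharacter ℂ q}

/-- Bound the series of -L'/L termwise by |χ(n)Λ(n)| ≤ log n. The threshold 8/5 is a rational number
just below φ. -/
theorem norm_logDeriv_LFunction_le (χ : DirichletCharacter ℂ q) {s : ℂ} (hs : 8 / 5 ≤ s.re) :
    ‖logDeriv χ.LFunction s‖ ≤ 63 / 20 := by
  have hs1 : 1 < s.re := by linarith
  have hL := LSeries_twist_vonMangoldt_eq χ hs1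
  have h1 : logDeriv χ.LFunction s =
      -LSeries ((fun n : ℕ => χ n) * fun n => (ArithmeticFunction.vonMangoldt n : ℂ)) s := by
    rw [hL, logDeriv_apply, deriv_LFunction_eq_deriv_LSeries χ hs1, LFunction_eq_LSeries χ hs1]
    ring
  have hnn : ∀ i : ℕ, 0 ≤ Real.log i / (i : ℝ) ^ (8 / 5 : ℝ) := fun i =>
    div_nonneg (Real.log_natCast_nonneg i) (by positivity)
  rw [h1, norm_neg]
  refine (tsum_of_norm_bounded (summable_of_sum_range_le hnn sum_range_log_div_rpow_le).hasSum
    fun n => ?_).trans (Real.tsum_le_of_sum_range_le hnn sum_range_log_div_rpow_le)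
  rcases eq_or_ne n 0 with rfl | hn
  · simp
  have hn1 : (1 : ℝ) ≤ n := by exact_mod_cast Nat.one_le_iff_ne_zero.mpr hn
  rw [LSeries.term_of_ne_zero hn, norm_div, norm_natCast_cpow_of_pos (Nat.pos_of_ne_zero hn),
    Pi.mul_apply, norm_mul, norm_real,
    Real.norm_of_nonneg ArithmeticFunction.vonMangoldt_nonneg]
  have h2 : ‖χ n‖ * ArithmeticFunction.vonMangoldt n ≤ Real.log n :=
    (mul_le_of_le_one_left ArithmeticFunction.vonMangoldt_nonneg (χ.norm_le_one _)).trans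
      ArithmeticFunction.vonMangoldt_le_log
  exact div_le_div₀ (Real.log_natCast_nonneg n) h2 (by positivity)
    (Real.rpow_le_rpow_of_exponent_le hn1 hs)

/-! ### Transfer between L(s, χ) and its normalised completion -/

theorem gammaFactor_ne_zero {n : ℕ} (χ : DirichletCharacter ℂ n) {s : ℂ} (hs : 0 < s.re) :
    χ.gammaFactor s ≠ 0 := by
  rw [gammaFactor]
  split_ifs
  · exact Gammaℝ_ne_zero_of_re_pos hs
  · exact Gammaℝ_ne_zero_of_re_pos (by simp; linarith)

theorem differentiableAt_gammaFactor {n : ℕ} (χ : DirichletCharacter ℂ n) {s : ℂ}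
    (hs : 0 < s.re) : DifferentiableAt ℂ χ.gammaFactor s := by
  rcases χ.even_or_odd with h | h
  · rw [show χ.gammaFactor = Gammaℝ from funext h.gammaFactor_def]
    exact differentiableAt_Gammaℝ hs
  · rw [show χ.gammaFactor = fun s => Gammaℝ (s + 1) from funext h.gammaFactor_def]
    have : DifferentiableAt ℂ Gammaℝ (s + 1) := differentiableAt_Gammaℝ (by simp; linarith)
    exact DifferentiableAt.comp (f := fun s : ℂ => s + 1) s this (by fun_prop)

theorem normalizedLFunction_eventuallyEq (hq : q ≠ 1) {s : ℂ} (hs : 0 < s.re) :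
    χ.normalizedLFunction =ᶠ[𝓝 s]
      (fun s : ℂ => (q : ℂ) ^ (s / 2)) * (χ.LFunction * χ.gammaFactor) := by
  filter_upwards [(isOpen_lt continuous_const continuous_re).mem_nhds hs] with z (hz : 0 < z.re)
  rw [normalizedLFunction, completedLFunction_eq_LFunction_mul_gammaFactor hq hz]
  rfl

theorem logDeriv_normalizedLFunction (hχ : χ ≠ 1) {s : ℂ} (hs : 0 < s.re)
    (hL : χ.LFunction s ≠ 0) :
    logDeriv χ.normalizedLFunction s =
      ((1 / 2 * Real.log q : ℝ) : ℂ) + (logDeriv χ.LFunction s + logDeriv χ.gammaFactor s) := by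
  have hq : q ≠ 1 := hχ ∘ level_one' _
  have hq0 : (q : ℂ) ≠ 0 := NeZero.ne _
  have h2 : HasDerivAt (fun s : ℂ => (q : ℂ) ^ (s / 2))
      ((q : ℂ) ^ (s / 2) * Complex.log q * (1 / 2)) s :=
    HasDerivAt.const_cpow ((hasDerivAt_id _).div_const 2) (Or.inl hq0)
  have hp : (q : ℂ) ^ (s / 2) ≠ 0 := by simp [hq0]
  have hγ := χ.gammaFactor_ne_zero hs
  have hdL := differentiable_LFunction hχ s
  have hdγ := χ.differentiableAt_gammaFactor hs
  have h3 := logDeriv_mul (f := χ.LFunction) (g := χ.gammaFactor) s hL hγ hdL hdγ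
  have h4 := logDeriv_mul (f := fun s : ℂ => (q : ℂ) ^ (s / 2))
    (g := fun s => χ.LFunction s * χ.gammaFactor s) s hp (mul_ne_zero hL hγ) h2.differentiableAt
    (hdL.mul hdγ)
  refine (logDeriv_congr_nhds (normalizedLFunction_eventuallyEq hq hs)).eq_of_nhds.trans
    (h4.trans ?_)
  rw [h3, logDeriv_apply, h2.deriv]
  congr 1
  rw [ofReal_mul, ofReal_log (by positivity), ofReal_natCast]
  push_cast
  field_simp

theorem analyticOrderAt_normalizedLFunction (hχ : χ ≠ 1) {s : ℂ} (hs : 0 < s.re) :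
    analyticOrderAt χ.normalizedLFunction s = analyticOrderAt χ.LFunction s := by
  have hq : q ≠ 1 := hχ ∘ level_one' _
  have hq0 : (q : ℂ) ≠ 0 := NeZero.ne _
  have hpd : Differentiable ℂ fun s : ℂ => (q : ℂ) ^ (s / 2) := by fun_prop
  have hpa := hpd.analyticAt s
  have hLa := (differentiable_LFunction hχ).analyticAt s
  have hγa : AnalyticAt ℂ χ.gammaFactor s := by
    rw [analyticAt_iff_eventually_differentiableAt]
    filter_upwards [(isOpen_lt continuous_const continuous_re).mem_nhds hs] with z hz
    exact χ.differentiableAt_gammaFactor hz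
  have hp0 : analyticOrderAt (fun s : ℂ => (q : ℂ) ^ (s / 2)) s = 0 :=
    analyticOrderAt_eq_zero.mpr (Or.inr (by simp [hq0]))
  rw [analyticOrderAt_congr (normalizedLFunction_eventuallyEq hq hs),
    analyticOrderAt_mul hpa (hLa.mul hγa), analyticOrderAt_mul hLa hγa,
    analyticOrderAt_eq_zero.mpr (Or.inr (χ.gammaFactor_ne_zero hs)), hp0, zero_add, add_zero]

theorem normalizedLFunction_eq_zero_iff (hχ : χ ≠ 1) {s : ℂ} (hs : 0 < s.re) :
    χ.normalizedLFunction s = 0 ↔ χ.LFunction s = 0 := by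
  have hq : q ≠ 1 := hχ ∘ level_one' _
  have hq0 : (q : ℂ) ≠ 0 := NeZero.ne _
  rw [normalizedLFunction, completedLFunction_eq_LFunction_mul_gammaFactor hq hs]
  simp [hq0, χ.gammaFactor_ne_zero hs]

theorem normalizedLFunction_ne_zero_of_one_le_re (hχ : χ ≠ 1) {s : ℂ} (hs : 1 ≤ s.re) :
    χ.normalizedLFunction s ≠ 0 := by
  rw [ne_eq, normalizedLFunction_eq_zero_iff hχ (by linarith)]
  exact LFunction_ne_zero_of_one_le_re χ (Or.inl hχ) hs

theorem IsPrimitive.rootNumber_ne_zero (hχ : χ.IsPrimitive) (h1 : χ ≠ 1) : rootNumber χ ≠ 0 := by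
  intro h
  have := hχ.normalizedLFunction_criticalReflection h1 (criticalReflection 2)
  rw [criticalReflection_involutive, h, zero_mul] at this
  exact normalizedLFunction_ne_zero_of_one_le_re h1 (by simp) this

theorem IsPrimitive.re_mem_of_normalizedLFunction_eq_zero (hχ : χ.IsPrimitive) (h1 : χ ≠ 1) {s : ℂ}
    (hs : χ.normalizedLFunction s = 0) : 0 < s.re ∧ s.re < 1 := by
  refine ⟨?_, not_le.mp fun h => normalizedLFunction_ne_zero_of_one_le_re h1 h hs⟩
  by_contra! h
  refine normalizedLFunction_ne_zero_of_one_le_re h1 (s := criticalReflection s)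
    (by simp [criticalReflection, h]) ?_
  rw [hχ.normalizedLFunction_criticalReflection h1, hs, map_zero, mul_zero]

end DirichletCharacter

end Dirichlet

/-! ### Conclusion -/

open DirichletCharacter in
theorem mainTheorem7 (q : ℕ) [NeZero q] (hq : 2 ≤ q) (χ : DirichletCharacter ℂ q)
    (hχ : χ.IsPrimitive) (S : Multiset ℂ) (hS : χ.IsFiniteFamilyOfNontrivialZeros S) :
    (S.map fun ρ : ℂ => (1 / (1 - ρ)).re).sum
      < (1 - 1 / Real.sqrt 5) * (1 / 2) * Real.log (q : ℝ)
        + (deriv χ.LFunction 1 / χ.LFunction 1).re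
        + (1 + 1 / Real.sqrt 5) * ((2 * (S.card : ℝ) + 3) / 2) - 1 := by
  have h1 := hχ.ne_one hq
  obtain ⟨C, hC⟩ := exists_norm_normalizedLFunction_le hχ h1
  have hmain := sum_re_one_div_one_sub_le (differentiable_normalizedLFunction h1) hC
    (hχ.normalizedLFunction_criticalReflection h1) (hχ.rootNumber_ne_zero h1)
    (fun s => hχ.re_mem_of_normalizedLFunction_eq_zero h1) (S := S) (fun ρ hρ => by
      obtain ⟨⟨h0, -, hL⟩, hcount⟩ := hS ρ hρ
      rw [normalizedLFunction_eq_zero_iff h1 h0, analyticOrderAt_normalizedLFunction h1 h0]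
      exact ⟨hL, hcount⟩)
  have h5 : (2.236 : ℝ) < √5 := Real.lt_sqrt_of_sq_lt (by norm_num)
  have h5' : √5 < (2.237 : ℝ) := (Real.sqrt_lt' (by norm_num)).mpr (by norm_num)
  have hφ : 8 / 5 ≤ Real.goldenRatio := by rw [Real.goldenRatio]; linarith
  have hκ : 1 / √5 < 0.4473 := by
    rw [div_lt_iff₀ (by linarith)]; linarith
  have hκ' : 0.447 < 1 / √5 := by
    rw [lt_div_iff₀ (by linarith)]; linarith
  set κ := 1 / √5
  rw [logDeriv_normalizedLFunction h1 (by simp)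
      (LFunction_ne_zero_of_one_le_re χ (Or.inl h1) (by simp)),
    logDeriv_normalizedLFunction h1 (by rw [ofReal_re]; linarith)
      (LFunction_ne_zero_of_one_le_re χ (Or.inl h1) (by rw [ofReal_re]; linarith)),
    add_re, add_re, add_re, add_re, ofReal_re, logDeriv_apply χ.LFunction 1] at hmain
  have hγ := re_logDeriv_gammaFactor_sub_le χ (κ := κ) (by linarith) (by linarith)
    (φ := Real.goldenRatio) (by linarith)
  have hLφ := (abs_le.mp ((abs_re_le_norm _).trans
    (norm_logDeriv_LFunction_le χ (s := Real.goldenRatio) (by rwa [ofReal_re])))).1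
  have hπ : 1 < Real.log Real.pi := by
    rw [Real.lt_log_iff_exp_lt Real.pi_pos]
    linarith [Real.exp_one_lt_d9, Real.pi_gt_three]
  have h2 := mul_le_mul_of_nonneg_left hLφ (by linarith : 0 ≤ κ)
  have h3 := mul_lt_mul_of_pos_left hπ (by linarith : 0 < (1 - κ) / 2)
  have h4 : 0 ≤ κ * (S.card : ℝ) := by
    have : 0 ≤ κ := by linarith
    positivity
  -- After dropping κ|S| ≥ 0, what is left is (63/20)κ - (1-κ)/2 < 1/2 + 3κ/2, that is 2.15κ < 1; κ
  -- < 0.4473 suffices.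
  linarith
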